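/- **Setting.** Let $\gamma\in[0,1)$, $\sigma_n,\sigma_\theta>0$, and let $\mathcal S\subset\mathbb R^d$ be a bounded state space. Let $\bar\kappa$ be a real, shift-invariant kernel on $\mathbb R^d$ with $\bar\kappa(\mathbf s,\mathbf s)=1$ and $\bar\kappa\le 1$, given by $\bar\kappa(\mathbf s,\mathbf s')=\mathbb E_{\zeta\sim\pi}\,e^{j\zeta^\top(\mathbf s-\mathbf s')}$ for a probability measure $\pi$ on $\mathbb R^d$, and let $\mathcal H$ be the reproducing kernel Hilbert space on $\mathcal S$ of $\kappa=\sigma_\theta^2\bar\kappa$. Draw $\zeta_1,\dots,\zeta_D$ i.i.d. from $\pi$ and let $$\phi_\zeta(\mathbf s)=\tfrac1{\sqrt D}\big[\sin\zeta_1^\top \mathbf s,\ \cos\zeta_1^\top \mathbf s,\dots,\sin\zeta_D^\top \mathbf s,\ \cos\zeta_D^\top \mathbf s\big]^\top\in\mathbb R^{2D}.$$ For a given trajectory of states $\mathbf s_1,\mathbf s_2,\dots\in\mathcal S$ and rewards $r_1,r_2,\dots\in\mathbb R$ put $\mathbf h_t=\phi_\zeta(\mathbf s_t)-\gamma\phi_\zeta(\mathbf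 s_{t+1})$. The OS-GPTD estimates are defined by $\hat\theta_0=\mathbf 0$, $\Sigma_0=\sigma_\theta^2\mathbf I_{2D}$ and, for $t\ge1$, $$\hat\theta_t=\hat\theta_{t-1}+\frac{\Sigma_{t-1}\mathbf h_t(r_t-\mathbf h_t^\top\hat\theta_{t-1})}{\mathbf h_t^\top\Sigma_{t-1}\mathbf h_t+\sigma_n^2},\qquad \Sigma_t=\Sigma_{t-1}-\frac{\Sigma_{t-1}\mathbf h_t\mathbf h_t^\top\Sigma_{t-1}}{\mathbf h_t^\top\Sigma_{t-1}\mathbf h_t+\sigma_n^2}.$$ Let $\bar v_t=\sum_{\tau\ge t}\gamma^{\tau-t}r_\tau$, $e_t=\phi_\zeta(\mathbf s_t)^\top\hat\theta_{t-1}-\bar v_t$ and, for $v^*\in\mathcal H$, $e_t^*=v^*(\mathbf s_t)-\bar v_t$. **Theorem.** Let $B_e,C\in\mathbb R$ and $\epsilon>0$. There are constants $A,c>0$ and $T_0\in\mathbb N$, which do not depend on $D$ or on the trajectory, such that for every $D\ge1$ and every trajectory as above the following holds with probability at least $1-Ae^{-cD}$ over the draw of the features: if the online Bellman errors satisfy $|r_t-\mathbf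 h_t^\top\hat\theta_{t-1}|\le B_e$ for all $t\ge1$, then for every $v^*\in\mathcal H$ with $\|v^*\|_{\mathcal H}\le C$ and $|r_t-v^*(\mathbf s_t)+\gamma v^*(\mathbf s_{t+1})|\le B_e$ for all $t\ge1$, and for every $T\ge T_0$, $$\frac1T\sum_{t=1}^Te_t^2\ \le\ \frac{2(1+\gamma)^2}{(1-\gamma)^2}\cdot\frac1T\sum_{t=1}^Te_t^{*2}+\epsilon .$$ In other words, with high probability, in the limit $T\to\infty$ and $D\to\infty$, the average squared long-term reward prediction error of OS-GPTD is at most $2(1+\gamma)^2/(1-\gamma)^2$ times that of the best fixed estimator in the RKHS. -/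

import Mathlib

open MeasureTheory
open scoped Matrix

noncomputable section

namespace OSGPTD

/-- The ambient Euclidean space `ℝ^d` of the states and of the random frequencies. -/
abbrev E (d : ℕ) : Type := EuclideanSpace ℝ (Fin d)

/-- Index set of the `2D` coordinates of the random feature vector: `(i, 0)` is the sine and
`(i, 1)` the cosine of the `i`-th frequency. -/
abbrev Idx (D : ℕ) : Type := Fin D × Fin 2

/-- `κbar` is a shift-invariant, standardized kernel, bounded by one, whose power spectral
distribution is the probability measure `π`, i.e. `κbar s s' = 𝔼_{ζ ∼ π} exp (j ζᵀ (s - s'))`. -/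
structure IsStandardizedKernel {d : ℕ} (κbar : E d → E d → ℝ) (π : Measure (E d)) : Prop where
  shift_invariant : ∀ s s' a : E d, κbar (s + a) (s' + a) = κbar s s'
  standardized : ∀ s : E d, κbar s s = 1
  bounded : ∀ s s' : E d, κbar s s' ≤ 1
  spectral : ∀ s s' : E d, (κbar s s' : ℂ) = charFun π (s - s')

/-- The law of `D` i.i.d. frequencies drawn from `π`. -/
def freqLaw {d : ℕ} (π : Measure (E d)) (D : ℕ) : Measure (Fin D → E d) :=
  Measure.pi fun _ => π

/-- The random feature vector `φ_ζ(s) ∈ ℝ^{2D}`. -/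
def feature {d D : ℕ} (ζ : Fin D → E d) (s : E d) : Idx D → ℝ := fun k =>
  (1 / √(D : ℝ)) *
    (if k.2 = 0 then Real.sin (inner ℝ (ζ k.1) s) else Real.cos (inner ℝ (ζ k.1) s))

/-- The regressor `h_t = φ_ζ(s_t) - γ φ_ζ(s_{t+1})`. -/
def regressor {d D : ℕ} (γ : ℝ) (ζ : Fin D → E d) (s : ℕ → E d) (t : ℕ) : Idx D → ℝ :=
  feature ζ (s t) - γ • feature ζ (s (t + 1))

/-- Posterior mean and covariance `(θ̂_t, Σ_t)` after slot `t`. Slots are numbered from `1`; the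
entries `s 0` and `r 0` of the trajectory are never used. -/
def posterior {d D : ℕ} (γ σn σθ : ℝ) (ζ : Fin D → E d) (s : ℕ → E d) (r : ℕ → ℝ) :
    ℕ → (Idx D → ℝ) × Matrix (Idx D) (Idx D) ℝ
  | 0 => (0, σθ ^ 2 • (1 : Matrix (Idx D) (Idx D) ℝ))
  | t + 1 =>
    let θ := (posterior γ σn σθ ζ s r t).1
    let S := (posterior γ σn σθ ζ s r t).2
    let h := regressor γ ζ s (t + 1)
    let q := h ⬝ᵥ (S *ᵥ h) + σn ^ 2
    (θ + ((r (t + 1) - h ⬝ᵥ θ) / q) • (S *ᵥ h),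
      S - (1 / q) • Matrix.vecMulVec (S *ᵥ h) (h ᵥ* S))

/-- The posterior mean `θ̂_t`. -/
def thetaHat {d D : ℕ} (γ σn σθ : ℝ) (ζ : Fin D → E d) (s : ℕ → E d) (r : ℕ → ℝ) (t : ℕ) :
    Idx D → ℝ :=
  (posterior γ σn σθ ζ s r t).1

/-- The (signed) online Bellman error `r_t - h_tᵀ θ̂_{t-1}`, for `t ≥ 1`. -/
def onlineBellman {d D : ℕ} (γ σn σθ : ℝ) (ζ : Fin D → E d) (s : ℕ → E d) (r : ℕ → ℝ)
    (t : ℕ) : ℝ :=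
  r t - regressor γ ζ s t ⬝ᵥ thetaHat γ σn σθ ζ s r (t - 1)

/-- The (signed) Bellman error `r_t - v(s_t) + γ v(s_{t+1})` of a fixed function `v`. -/
def fixedBellman {X : Type*} (γ : ℝ) (v : X → ℝ) (s : ℕ → X) (r : ℕ → ℝ) (t : ℕ) : ℝ :=
  r t - v (s t) + γ * v (s (t + 1))

/-- The discounted sum of future rewards `v̄_t = ∑_{τ ≥ t} γ^{τ-t} r_τ`. -/
def longTermReward (γ : ℝ) (r : ℕ → ℝ) (t : ℕ) : ℝ := ∑' k : ℕ, γ ^ k * r (t + k)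

/-- The online prediction error `e_t = φ_ζ(s_t)ᵀ θ̂_{t-1} - v̄_t`, for `t ≥ 1`. -/
def onlineError {d D : ℕ} (γ σn σθ : ℝ) (ζ : Fin D → E d) (s : ℕ → E d) (r : ℕ → ℝ)
    (t : ℕ) : ℝ :=
  feature ζ (s t) ⬝ᵥ thetaHat γ σn σθ ζ s r (t - 1) - longTermReward γ r t

/-- The prediction error `e_t^* = v(s_t) - v̄_t` of a fixed function `v`. -/
def fixedError {X : Type*} (γ : ℝ) (v : X → ℝ) (s : ℕ → X) (r : ℕ → ℝ) (t : ℕ) : ℝ :=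
  v (s t) - longTermReward γ r t

/-- The average `(1/T) ∑_{t=1}^T e_t²`. -/
def avgSq (e : ℕ → ℝ) (T : ℕ) : ℝ := (∑ t ∈ Finset.Icc 1 T, e t ^ 2) / T

end OSGPTD

end

namespace OSGPTD

/-! ### Deterministic regret analysis of recursive least squares. -/

section RecursiveLeastSquares

variable {ι : Type*} [Fintype ι]

/-! Randomness enters through a single event: the feature kernel `φ(s) ⬝ᵥ φ(s')` is uniformly close
to `κbar` on the state space. By `uniform_kernel_concentration` its failure is exponentially
unlikely in `D`. On this event the argument is deterministic, so all `v` and `T` are covered at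
once.

OS-GPTD is recursive least squares with temporal-difference regressors. `IsRLS.regret_identity`
compares its online Bellman residuals with those of any fixed weight vector, at the price of `Be ^
2` times the sum of the relative variances `p / (p + σn ^ 2)`. A log-determinant bound on that sum
would involve the dimension `2D`. Instead, `IsRLS.sum_ratio_le` sorts the slots into finitely many
cells of nearby regressors; once a cell has been visited often, the variance in it is small. The sum
is thus at most `ρ T` plus a constant, with `ρ` as small as desired and nothing depending on `D`.

An RKHS comparator becomes a weight vector in two moves: a kernel expansion on a fixed finite set of
centres, with coefficients bounded over the ball (`exists_kernel_expansion`), then replacement of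
the kernel by the feature kernel (`exists_weights_of_expansion`).

Prediction errors and Bellman errors are linked by `u t - γ * u (t + 1)`, which changes sums of
squares by factors between `(1 - γ) ^ 2` and `(1 + γ) ^ 2`, up to a boundary term. For the online
predictor this difference also contains the drift of the estimate during one update. Splitting off
the drift costs the factor 2, and its squares are again controlled by the relative variances. -/

theorem dotProduct_sq_le (x y : ι → ℝ) : (x ⬝ᵥ y) ^ 2 ≤ (x ⬝ᵥ x) * (y ⬝ᵥ y) := by
  have := Finset.sum_mul_sq_le_sq_mul_sq Finset.univ x y
  simpa [dotProduct, sq] using this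

theorem dotProduct_self_nonneg_real (x : ι → ℝ) : 0 ≤ x ⬝ᵥ x :=
  Finset.sum_nonneg fun i _ => mul_self_nonneg (x i)

/-- The recursion of Bayesian linear regression with regressors `h 1, h 2, …`, targets
`r 1, r 2, …`, noise level `σn` and prior covariance `σθ ^ 2 • 1`. -/
structure IsRLS [DecidableEq ι] (σn σθ : ℝ) (h : ℕ → ι → ℝ) (r : ℕ → ℝ) (θ : ℕ → ι → ℝ)
    (S : ℕ → Matrix ι ι ℝ) : Prop where
  mean_zero : θ 0 = 0
  cov_zero : S 0 = σθ ^ 2 • (1 : Matrix ι ι ℝ)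
  mean_succ : ∀ t, θ (t + 1) = θ t + ((r (t + 1) - h (t + 1) ⬝ᵥ θ t) /
    (h (t + 1) ⬝ᵥ (S t *ᵥ h (t + 1)) + σn ^ 2)) • (S t *ᵥ h (t + 1))
  cov_succ : ∀ t, S (t + 1) = S t - (1 / (h (t + 1) ⬝ᵥ (S t *ᵥ h (t + 1)) + σn ^ 2)) •
    Matrix.vecMulVec (S t *ᵥ h (t + 1)) (h (t + 1) ᵥ* S t)

/-- The bilinear form of the posterior precision matrix after `t` slots. -/
noncomputable def precForm (σn σθ : ℝ) (h : ℕ → ι → ℝ) (t : ℕ) (x y : ι → ℝ) : ℝ :=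
  x ⬝ᵥ y / σθ ^ 2 + ∑ τ ∈ Finset.range t, (h (τ + 1) ⬝ᵥ x) * (h (τ + 1) ⬝ᵥ y) / σn ^ 2

theorem precForm_succ (σn σθ : ℝ) (h : ℕ → ι → ℝ) (t : ℕ) (x y : ι → ℝ) :
    precForm σn σθ h (t + 1) x y =
      precForm σn σθ h t x y + (h (t + 1) ⬝ᵥ x) * (h (t + 1) ⬝ᵥ y) / σn ^ 2 := by
  simp [precForm, Finset.sum_range_succ, add_assoc]

theorem precForm_add_smul_right (σn σθ : ℝ) (h : ℕ → ι → ℝ) (t : ℕ) (x y z : ι → ℝ) (a : ℝ) :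
    precForm σn σθ h t x (y + a • z) =
      precForm σn σθ h t x y + a * precForm σn σθ h t x z := by
  simp only [precForm, dotProduct_add, dotProduct_smul, smul_eq_mul, mul_add, Finset.mul_sum]
  rw [show ∀ p q u v : ℝ, p + q + (u + v) = p + u + (q + v) by intros; ring,
    ← Finset.sum_add_distrib]
  congr 1
  · ring
  · exact Finset.sum_congr rfl fun _ _ => by ring

theorem precForm_comm (σn σθ : ℝ) (h : ℕ → ι → ℝ) (t : ℕ) (x y : ι → ℝ) :
    precForm σn σθ h t x y = precForm σn σθ h t y x := by
  simp only [precForm, dotProduct_comm x y, mul_comm]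

theorem precForm_self_nonneg (σn σθ : ℝ) (h : ℕ → ι → ℝ) (t : ℕ) (x : ι → ℝ) :
    0 ≤ precForm σn σθ h t x x :=
  add_nonneg (div_nonneg (dotProduct_self_nonneg_real x) (sq_nonneg _))
    (Finset.sum_nonneg fun _ _ => div_nonneg (mul_self_nonneg _) (sq_nonneg _))

namespace IsRLS

variable [DecidableEq ι] {σn σθ : ℝ} {h : ℕ → ι → ℝ} {r : ℕ → ℝ} {θ : ℕ → ι → ℝ}
  {S : ℕ → Matrix ι ι ℝ}

theorem cov_transpose (H : IsRLS σn σθ h r θ S) (t : ℕ) : (S t)ᵀ = S t := by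
  induction t with
  | zero => simp [H.cov_zero]
  | succ t ih =>
    rw [H.cov_succ, Matrix.transpose_sub, Matrix.transpose_smul, Matrix.transpose_vecMulVec, ih,
      ← Matrix.mulVec_transpose, ih]

theorem vecMul_cov (H : IsRLS σn σθ h r θ S) (t : ℕ) (x : ι → ℝ) : x ᵥ* S t = S t *ᵥ x := by
  rw [← Matrix.mulVec_transpose, H.cov_transpose]

/-- Sherman–Morrison in weak form: the covariance inverts the precision form, so no matrix inverse
is needed. The rank-one downdate of `S` cancels the rank-one term gained by the precision. -/
theorem precForm_cov (H : IsRLS σn σθ h r θ S) (hσn : 0 < σn) (hσθ : 0 < σθ) (t : ℕ) :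
    ∀ x y : ι → ℝ, precForm σn σθ h t x (S t *ᵥ y) = x ⬝ᵥ y := by
  induction t with
  | zero =>
    intro x y
    simp only [precForm, H.cov_zero, Matrix.smul_mulVec, Matrix.one_mulVec, dotProduct_smul,
      Finset.range_zero, Finset.sum_empty, smul_eq_mul, add_zero]
    field_simp
  | succ t ih =>
    intro x y
    set g := h (t + 1) with hg
    set u := S t *ᵥ g with hu
    set q := g ⬝ᵥ u + σn ^ 2 with hq
    -- By the induction hypothesis this variance is the precision form at `u`, hence nonnegative.
    have hp : 0 ≤ g ⬝ᵥ u := by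
      have h1 := ih u g
      rw [dotProduct_comm, ← h1]
      exact precForm_self_nonneg _ _ _ _ _
    have hqpos : 0 < q := by positivity
    have hS : S (t + 1) *ᵥ y = S t *ᵥ y + (-((u ⬝ᵥ y) / q)) • u := by
      rw [H.cov_succ, H.vecMul_cov, Matrix.sub_mulVec, Matrix.smul_mulVec,
        Matrix.vecMulVec_mulVec, ← hg, ← hu, ← hq]
      ext i
      simp [sub_eq_add_neg]
      ring
    have hgy : g ⬝ᵥ (S t *ᵥ y) = u ⬝ᵥ y := by
      rw [Matrix.dotProduct_mulVec, H.vecMul_cov]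
    rw [precForm_succ, hS, precForm_add_smul_right, ih, hu, ih, ← hu, ← hg, dotProduct_add,
      dotProduct_smul, hgy, dotProduct_comm g x, smul_eq_mul]
    have : g ⬝ᵥ u = q - σn ^ 2 := by rw [hq]; ring
    rw [this]
    field_simp
    ring

/-- The posterior variance of `g` is the precision form of its gain vector `S t *ᵥ g`. -/
theorem precForm_gain (H : IsRLS σn σθ h r θ S) (hσn : 0 < σn) (hσθ : 0 < σθ) (t : ℕ)
    (g : ι → ℝ) :
    g ⬝ᵥ (S t *ᵥ g) = precForm σn σθ h t (S t *ᵥ g) (S t *ᵥ g) := by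
  rw [H.precForm_cov hσn hσθ, dotProduct_comm]

theorem variance_nonneg (H : IsRLS σn σθ h r θ S) (hσn : 0 < σn) (hσθ : 0 < σθ) (t : ℕ)
    (g : ι → ℝ) : 0 ≤ g ⬝ᵥ (S t *ᵥ g) := by
  rw [H.precForm_gain hσn hσθ]
  exact precForm_self_nonneg _ _ _ _ _

/-- The prior part of the precision is dominated by the whole; in operator terms, the covariance
never exceeds `σθ ^ 2`. -/
theorem gain_sq_le (H : IsRLS σn σθ h r θ S) (hσn : 0 < σn) (hσθ : 0 < σθ) (t : ℕ)
    (g : ι → ℝ) :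
    (S t *ᵥ g) ⬝ᵥ (S t *ᵥ g) ≤ σθ ^ 2 * (g ⬝ᵥ (S t *ᵥ g)) := by
  rw [H.precForm_gain hσn hσθ, precForm, mul_add, mul_div_cancel₀ _ (by positivity)]
  have : 0 ≤ ∑ τ ∈ Finset.range t,
      (h (τ + 1) ⬝ᵥ (S t *ᵥ g)) * (h (τ + 1) ⬝ᵥ (S t *ᵥ g)) / σn ^ 2 :=
    Finset.sum_nonneg fun _ _ => div_nonneg (mul_self_nonneg _) (sq_nonneg _)
  nlinarith [sq_nonneg σθ, mul_nonneg (sq_nonneg σθ) this]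

/-- The exact regret identity of recursive least squares. -/
theorem regret_identity (H : IsRLS σn σθ h r θ S) (hσn : 0 < σn) (hσθ : 0 < σθ)
    (w : ι → ℝ) (t : ℕ) :
    ∑ τ ∈ Finset.range t, (r (τ + 1) - h (τ + 1) ⬝ᵥ w) ^ 2 + σn ^ 2 / σθ ^ 2 * (w ⬝ᵥ w) =
      ∑ τ ∈ Finset.range t, (r (τ + 1) - h (τ + 1) ⬝ᵥ θ τ) ^ 2 *
        (σn ^ 2 / (h (τ + 1) ⬝ᵥ (S τ *ᵥ h (τ + 1)) + σn ^ 2)) +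
      σn ^ 2 * precForm σn σθ h t (w - θ t) (w - θ t) := by
  induction t with
  | zero =>
    simp [precForm, H.mean_zero]
    ring
  | succ t ih =>
    rw [Finset.sum_range_succ, Finset.sum_range_succ, precForm_succ]
    have hp := H.variance_nonneg hσn hσθ t (h (t + 1))
    have hup : ∀ x, precForm σn σθ h t x (S t *ᵥ h (t + 1)) = x ⬝ᵥ h (t + 1) :=
      fun x => H.precForm_cov hσn hσθ t x _
    have hw : w - θ (t + 1) = (w - θ t) + (-((r (t + 1) - h (t + 1) ⬝ᵥ θ t) /
        (h (t + 1) ⬝ᵥ (S t *ᵥ h (t + 1)) + σn ^ 2))) • (S t *ᵥ h (t + 1)) := by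
      rw [H.mean_succ]; simp only [neg_smul]; abel
    have hy : r (t + 1) - h (t + 1) ⬝ᵥ w =
        (r (t + 1) - h (t + 1) ⬝ᵥ θ t) - h (t + 1) ⬝ᵥ (w - θ t) := by
      rw [dotProduct_sub]; ring
    rw [hw, hy]
    set b := r (t + 1) - h (t + 1) ⬝ᵥ θ t
    set g := h (t + 1)
    set u := S t *ᵥ g
    set x := w - θ t
    set q := g ⬝ᵥ u + σn ^ 2 with hq
    have hqpos : 0 < q := by positivity
    have hgu : g ⬝ᵥ u = q - σn ^ 2 := by rw [hq]; ring
    rw [precForm_add_smul_right, precForm_comm _ _ _ _ (x + _) x, precForm_comm _ _ _ _ (x + _) u,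
      precForm_add_smul_right, precForm_add_smul_right, hup, precForm_comm _ _ _ _ u x, hup, hup,
      dotProduct_add, dotProduct_smul, dotProduct_comm u g, dotProduct_comm x g, hgu, smul_eq_mul]
    rw [show ∀ p q s : ℝ, p + q + s = (p + s) + q by intros; ring, ih]
    generalize ∑ τ ∈ Finset.range t, (r (τ + 1) - h (τ + 1) ⬝ᵥ θ τ) ^ 2 *
        (σn ^ 2 / (h (τ + 1) ⬝ᵥ (S τ *ᵥ h (τ + 1)) + σn ^ 2)) = Q
    field_simp
    ring

/-- In the regret identity each online residual has weight `1 - p / (p + σn ^ 2)`; restoring weight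
1 costs at most `Be ^ 2` times the relative variance, and the last precision form is dropped. -/
theorem sum_sq_residual_le (H : IsRLS σn σθ h r θ S) (hσn : 0 < σn) (hσθ : 0 < σθ)
    (w : ι → ℝ) {Be : ℝ} (T : ℕ) (hb : ∀ t < T, |r (t + 1) - h (t + 1) ⬝ᵥ θ t| ≤ Be) :
    ∑ t ∈ Finset.range T, (r (t + 1) - h (t + 1) ⬝ᵥ θ t) ^ 2 ≤
      ∑ t ∈ Finset.range T, (r (t + 1) - h (t + 1) ⬝ᵥ w) ^ 2 + σn ^ 2 / σθ ^ 2 * (w ⬝ᵥ w) +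
      Be ^ 2 * ∑ t ∈ Finset.range T, h (t + 1) ⬝ᵥ (S t *ᵥ h (t + 1)) /
        (h (t + 1) ⬝ᵥ (S t *ᵥ h (t + 1)) + σn ^ 2) := by
  rw [H.regret_identity hσn hσθ w T]
  have h0 := mul_nonneg (sq_nonneg σn) (precForm_self_nonneg σn σθ h T (w - θ T))
  have : ∑ t ∈ Finset.range T, (r (t + 1) - h (t + 1) ⬝ᵥ θ t) ^ 2 ≤
      ∑ τ ∈ Finset.range T, (r (τ + 1) - h (τ + 1) ⬝ᵥ θ τ) ^ 2 *
        (σn ^ 2 / (h (τ + 1) ⬝ᵥ (S τ *ᵥ h (τ + 1)) + σn ^ 2)) +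
      Be ^ 2 * ∑ t ∈ Finset.range T, h (t + 1) ⬝ᵥ (S t *ᵥ h (t + 1)) /
        (h (t + 1) ⬝ᵥ (S t *ᵥ h (t + 1)) + σn ^ 2) := by
    rw [Finset.mul_sum, ← Finset.sum_add_distrib]
    refine Finset.sum_le_sum fun t ht => ?_
    have hp := H.variance_nonneg hσn hσθ t (h (t + 1))
    have hbt := sq_le_sq' (abs_le.1 (hb t (Finset.mem_range.1 ht))).1
      (abs_le.1 (hb t (Finset.mem_range.1 ht))).2
    set p := h (t + 1) ⬝ᵥ (S t *ᵥ h (t + 1))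
    have hq : 0 < p + σn ^ 2 := by positivity
    have hsplit : σn ^ 2 / (p + σn ^ 2) = 1 - p / (p + σn ^ 2) := by field_simp; ring
    rw [hsplit]
    have := mul_le_mul_of_nonneg_right hbt (div_nonneg hp hq.le)
    linarith
  linarith

/-- The change of a prediction along a unit vector caused by one update is controlled by the
relative variance of the regressor. -/
theorem sq_update_le (H : IsRLS σn σθ h r θ S) (hσn : 0 < σn) (hσθ : 0 < σθ) {Be : ℝ} (t : ℕ)
    (hb : |r (t + 1) - h (t + 1) ⬝ᵥ θ t| ≤ Be) (f : ι → ℝ) (hf : f ⬝ᵥ f ≤ 1) :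
    (f ⬝ᵥ (θ (t + 1) - θ t)) ^ 2 ≤ Be ^ 2 * σθ ^ 2 / σn ^ 2 *
      (h (t + 1) ⬝ᵥ (S t *ᵥ h (t + 1)) / (h (t + 1) ⬝ᵥ (S t *ᵥ h (t + 1)) + σn ^ 2)) := by
  have hd : θ (t + 1) - θ t = ((r (t + 1) - h (t + 1) ⬝ᵥ θ t) /
      (h (t + 1) ⬝ᵥ (S t *ᵥ h (t + 1)) + σn ^ 2)) • (S t *ᵥ h (t + 1)) := by
    rw [H.mean_succ]; abel
  have hp := H.variance_nonneg hσn hσθ t (h (t + 1))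
  have hu := H.gain_sq_le hσn hσθ t (h (t + 1))
  have hbt := sq_le_sq' (abs_le.1 hb).1 (abs_le.1 hb).2
  have hcs := dotProduct_sq_le f (S t *ᵥ h (t + 1))
  have hnn := dotProduct_self_nonneg_real (S t *ᵥ h (t + 1))
  rw [hd, dotProduct_smul, smul_eq_mul, mul_pow, div_pow]
  set p := h (t + 1) ⬝ᵥ (S t *ᵥ h (t + 1))
  set b := r (t + 1) - h (t + 1) ⬝ᵥ θ t
  have hq : 0 < p + σn ^ 2 := by positivity
  have hfu : (f ⬝ᵥ (S t *ᵥ h (t + 1))) ^ 2 ≤ σθ ^ 2 * p := by nlinarith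
  calc b ^ 2 / (p + σn ^ 2) ^ 2 * (f ⬝ᵥ (S t *ᵥ h (t + 1))) ^ 2
      ≤ Be ^ 2 / (p + σn ^ 2) ^ 2 * (σθ ^ 2 * p) := by gcongr
    _ = Be ^ 2 * σθ ^ 2 / (p + σn ^ 2) * (p / (p + σn ^ 2)) := by field_simp
    _ ≤ Be ^ 2 * σθ ^ 2 / σn ^ 2 * (p / (p + σn ^ 2)) := by
        gcongr
        linarith

theorem ratio_le_one (H : IsRLS σn σθ h r θ S) (hσn : 0 < σn) (hσθ : 0 < σθ) (t : ℕ)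
    (g : ι → ℝ) : g ⬝ᵥ (S t *ᵥ g) / (g ⬝ᵥ (S t *ᵥ g) + σn ^ 2) ≤ 1 := by
  have hp := H.variance_nonneg hσn hσθ t g
  exact div_le_one_of_le₀ (by nlinarith [sq_nonneg σn]) (by positivity)

theorem abs_update_le (H : IsRLS σn σθ h r θ S) (hσn : 0 < σn) (hσθ : 0 < σθ) {Be : ℝ} (t : ℕ)
    (hb : |r (t + 1) - h (t + 1) ⬝ᵥ θ t| ≤ Be) (f : ι → ℝ) (hf : f ⬝ᵥ f ≤ 1) :
    |f ⬝ᵥ (θ (t + 1) - θ t)| ≤ Be * σθ / σn := by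
  have hBe : 0 ≤ Be := (abs_nonneg _).trans hb
  refine abs_le_of_sq_le_sq ?_ (by positivity)
  refine (H.sq_update_le hσn hσθ t hb f hf).trans ?_
  refine (mul_le_of_le_one_right (by positivity) (H.ratio_le_one hσn hσθ t _)).trans_eq ?_
  rw [div_pow, mul_pow]

/-- If `k` earlier regressors are close to `g`, then the posterior variance of `g` is small. -/
theorem variance_le_of_card (H : IsRLS σn σθ h r θ S) (hσn : 0 < σn) (hσθ : 0 < σθ) (t : ℕ)
    (g : ι → ℝ) {η : ℝ} (J : Finset ℕ) (hJ : J ⊆ Finset.range t) {k : ℕ} (hk : 0 < k)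
    (hkJ : k ≤ J.card)
    (hη : ∀ τ ∈ J, (g - h (τ + 1)) ⬝ᵥ (g - h (τ + 1)) ≤ η) :
    g ⬝ᵥ (S t *ᵥ g) ≤ 2 * σn ^ 2 / k + 2 * η * σθ ^ 2 := by
  have hp := H.variance_nonneg hσn hσθ t g
  have hu := H.gain_sq_le hσn hσθ t g
  have hB := H.precForm_gain hσn hσθ t g
  have hJne : J.Nonempty := Finset.card_pos.1 (hk.trans_le hkJ)
  obtain ⟨τ₀, hτ₀⟩ := hJne
  have hη0 : 0 ≤ η := (dotProduct_self_nonneg_real _).trans (hη τ₀ hτ₀)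
  set u := S t *ᵥ g
  have hnn := dotProduct_self_nonneg_real u
  set p := g ⬝ᵥ u
  have hsum : ∑ τ ∈ J, (h (τ + 1) ⬝ᵥ u) ^ 2 ≤ σn ^ 2 * p := by
    have h1 : ∑ τ ∈ Finset.range t, (h (τ + 1) ⬝ᵥ u) * (h (τ + 1) ⬝ᵥ u) / σn ^ 2 ≤ p := by
      rw [hB, precForm]
      have : 0 ≤ u ⬝ᵥ u / σθ ^ 2 := by positivity
      linarith
    rw [← Finset.sum_div, div_le_iff₀ (by positivity)] at h1
    calc ∑ τ ∈ J, (h (τ + 1) ⬝ᵥ u) ^ 2 ≤ ∑ τ ∈ Finset.range t, (h (τ + 1) ⬝ᵥ u) ^ 2 :=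
          Finset.sum_le_sum_of_subset_of_nonneg hJ fun _ _ _ => sq_nonneg _
      _ ≤ σn ^ 2 * p := by simp only [sq] at h1 ⊢; linarith
  -- Here `p = g ⬝ᵥ u` is split along `h (τ + 1)`, the remainder being small by Cauchy–Schwarz.
  -- Averaging over `J` and cancelling one factor `p` then gives the bound.
  have hterm : ∀ τ ∈ J, p ^ 2 ≤ 2 * (h (τ + 1) ⬝ᵥ u) ^ 2 + 2 * η * σθ ^ 2 * p := by
    intro τ hτ
    have h1 : p = h (τ + 1) ⬝ᵥ u + (g - h (τ + 1)) ⬝ᵥ u := by rw [sub_dotProduct]; ring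
    have h2 : ((g - h (τ + 1)) ⬝ᵥ u) ^ 2 ≤ η * (σθ ^ 2 * p) :=
      (dotProduct_sq_le _ _).trans (mul_le_mul (hη τ hτ) hu hnn hη0)
    calc p ^ 2 = (h (τ + 1) ⬝ᵥ u + (g - h (τ + 1)) ⬝ᵥ u) ^ 2 := by rw [← h1]
      _ ≤ 2 * (h (τ + 1) ⬝ᵥ u) ^ 2 + 2 * ((g - h (τ + 1)) ⬝ᵥ u) ^ 2 := by
          nlinarith [sq_nonneg (h (τ + 1) ⬝ᵥ u - (g - h (τ + 1)) ⬝ᵥ u)]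
      _ ≤ _ := by linarith
  have hall := Finset.sum_le_sum hterm
  rw [Finset.sum_add_distrib, ← Finset.mul_sum, Finset.sum_const, Finset.sum_const,
    nsmul_eq_mul, nsmul_eq_mul] at hall
  have hk' : (0 : ℝ) < k := by exact_mod_cast hk
  have hkJ' : (k : ℝ) ≤ J.card := by exact_mod_cast hkJ
  rcases hp.eq_or_lt with hp0 | hp0
  · rw [← hp0]; positivity
  · have h3 : (J.card : ℝ) * p ≤ 2 * σn ^ 2 + J.card * (2 * η * σθ ^ 2) := by
      refine le_of_mul_le_mul_right ?_ hp0
      nlinarith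
    have h4 : p - 2 * η * σθ ^ 2 ≤ 2 * σn ^ 2 / J.card := by
      rw [le_div_iff₀ (hk'.trans_le hkJ')]
      nlinarith
    have h5 : 2 * σn ^ 2 / (J.card : ℝ) ≤ 2 * σn ^ 2 / k := by gcongr
    linarith

end IsRLS

/-- At most `k * card α` time slots see fewer than `k` earlier visits of their own cell. -/
theorem card_filter_few_visits {α : Type*} [Fintype α] [DecidableEq α] (c : ℕ → α) (k T : ℕ) :
    ((Finset.range T).filter fun t =>
      ((Finset.range t).filter fun τ => c τ = c t).card < k).card ≤ Fintype.card α * k := by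
  have hmap : ((Finset.range T).filter fun t =>
      ((Finset.range t).filter fun τ => c τ = c t).card < k).card ≤
      ((Finset.univ : Finset α) ×ˢ Finset.range k).card := by
    -- A slot is determined by its cell together with the number of earlier visits to that cell.
    refine Finset.card_le_card_of_injOn
      (fun t => (c t, ((Finset.range t).filter fun τ => c τ = c t).card)) ?_ ?_
    · intro t ht
      simp at ht ⊢
      exact ht.2
    · have key : ∀ t t', t < t' → c t = c t' →
          ((Finset.range t).filter fun τ => c τ = c t).card <
          ((Finset.range t').filter fun τ => c τ = c t').card := by
        intro t t' htt' hc
        refine Finset.card_lt_card ?_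
        rw [Finset.ssubset_iff_of_subset]
        · exact ⟨t, by simp [htt', hc], by simp⟩
        · intro τ hτ
          simp only [Finset.mem_filter, Finset.mem_range] at hτ ⊢
          exact ⟨hτ.1.trans htt', hτ.2.trans hc⟩
      intro t _ t' _ heq
      simp only [Prod.mk.injEq] at heq
      rcases lt_trichotomy t t' with hlt | rfl | hlt
      · exact absurd heq.2 (key t t' hlt heq.1).ne
      · rfl
      · exact absurd heq.2 (key t' t hlt heq.1.symm).ne'
  simpa [Finset.card_product] using hmap

/-- If regressors of the same cell are close, the accumulated relative variances grow at a small
linear rate, up to a constant governed by the number of cells only. -/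
theorem IsRLS.sum_ratio_le [DecidableEq ι] {σn σθ : ℝ} {h : ℕ → ι → ℝ} {r : ℕ → ℝ}
    {θ : ℕ → ι → ℝ} {S : ℕ → Matrix ι ι ℝ} (H : IsRLS σn σθ h r θ S) (hσn : 0 < σn)
    (hσθ : 0 < σθ) {α : Type*} [Fintype α] [DecidableEq α] (c : ℕ → α) {η : ℝ} (hη0 : 0 ≤ η)
    (hc : ∀ t τ, c t = c τ →
      (h (t + 1) - h (τ + 1)) ⬝ᵥ (h (t + 1) - h (τ + 1)) ≤ η)
    {k : ℕ} (hk : 0 < k) (T : ℕ) :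
    ∑ t ∈ Finset.range T, h (t + 1) ⬝ᵥ (S t *ᵥ h (t + 1)) /
        (h (t + 1) ⬝ᵥ (S t *ᵥ h (t + 1)) + σn ^ 2) ≤
      Fintype.card α * k + (2 / k + 2 * η * σθ ^ 2 / σn ^ 2) * T := by
  set A := (Finset.range T).filter fun t =>
      ((Finset.range t).filter fun τ => c τ = c t).card < k with hA
  have hcard : (A.card : ℝ) ≤ Fintype.card α * k := by
    exact_mod_cast card_filter_few_visits c k T
  -- Slots with few earlier visits are charged the trivial bound 1; all others have small variance.
  have hterm : ∀ t ∈ Finset.range T, h (t + 1) ⬝ᵥ (S t *ᵥ h (t + 1)) /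
        (h (t + 1) ⬝ᵥ (S t *ᵥ h (t + 1)) + σn ^ 2) ≤
      (if t ∈ A then 1 else 0) + (2 / k + 2 * η * σθ ^ 2 / σn ^ 2) := by
    intro t ht
    have hpos : 0 ≤ 2 / (k : ℝ) + 2 * η * σθ ^ 2 / σn ^ 2 := by positivity
    split_ifs with htA
    · linarith [H.ratio_le_one hσn hσθ t (h (t + 1))]
    · have hk' : k ≤ ((Finset.range t).filter fun τ => c τ = c t).card := by
        by_contra hlt
        exact htA (Finset.mem_filter.2 ⟨ht, not_le.1 hlt⟩)
      have hv := H.variance_le_of_card hσn hσθ t (h (t + 1)) (η := η) _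
        (Finset.filter_subset _ _) hk hk'
        (fun τ hτ => hc t τ (Finset.mem_filter.1 hτ).2.symm)
      have hp := H.variance_nonneg hσn hσθ t (h (t + 1))
      rw [zero_add]
      calc _ ≤ h (t + 1) ⬝ᵥ (S t *ᵥ h (t + 1)) / σn ^ 2 := by
            gcongr
            linarith
        _ ≤ (2 * σn ^ 2 / k + 2 * η * σθ ^ 2) / σn ^ 2 := by gcongr
        _ = _ := by field_simp
  refine (Finset.sum_le_sum hterm).trans ?_
  rw [Finset.sum_add_distrib, Finset.sum_const, Finset.card_range, nsmul_eq_mul,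
    ← Finset.sum_filter, Finset.sum_const, nsmul_one]
  have : (Finset.range T).filter (· ∈ A) = A := by
    ext t; simp [hA]
  rw [this]
  linarith [mul_comm (T : ℝ) (2 / k + 2 * η * σθ ^ 2 / σn ^ 2)]

end RecursiveLeastSquares

/-! ### Uniform concentration of the random-feature kernel. -/

section Concentration

open ProbabilityTheory
open scoped Pointwise

variable {d : ℕ}

instance (π : Measure (E d)) [IsProbabilityMeasure π] (D : ℕ) :
    IsProbabilityMeasure (freqLaw π D) := by
  unfold freqLaw; infer_instance

theorem hoeffding_upper (π : Measure (E d)) [IsProbabilityMeasure π] {f : E d → ℝ}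
    (hf : Measurable f) (hb : ∀ x, |f x| ≤ 2) {ε : ℝ} (hε : 0 ≤ ε) (D : ℕ) :
    (freqLaw π D).real {ζ | ε * D ≤ ∑ i, (f (ζ i) - ∫ x, f x ∂π)} ≤
      Real.exp (-(ε ^ 2 / 8 * D)) := by
  rcases Nat.eq_zero_or_pos D with rfl | hD
  · simp
  have hind : iIndepFun (fun (i : Fin D) (ζ : Fin D → E d) => f (ζ i) - ∫ x, f x ∂π)
      (freqLaw π D) :=
    iIndepFun_pi (X := fun _ x => f x - ∫ x, f x ∂π)
      fun _ => (hf.sub_const _).aemeasurable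
  -- Values in `[-2, 2]` give variance proxy 4, whence the exponent `ε ^ 2 / 8`.
  have hsub : ∀ i ∈ (Finset.univ : Finset (Fin D)),
      HasSubgaussianMGF (fun ζ : Fin D → E d => f (ζ i) - ∫ x, f x ∂π)
        ((‖(2 : ℝ) - (-2)‖₊ / 2) ^ 2) (freqLaw π D) := by
    intro i _
    have hmp : MeasurePreserving (Function.eval i) (freqLaw π D) π :=
      measurePreserving_eval (fun _ => π) i
    have h1 := hasSubgaussianMGF_of_mem_Icc (μ := freqLaw π D)
      (X := fun ζ : Fin D → E d => f (ζ i)) (a := -2) (b := 2)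
      (hf.comp (measurable_pi_apply i)).aemeasurable
      (Filter.Eventually.of_forall fun ζ => abs_le.1 (hb _))
    have h2 : ∫ ζ, f (ζ i) ∂(freqLaw π D) = ∫ x, f x ∂π := by
      have h := integral_map (μ := freqLaw π D) hmp.measurable.aemeasurable
        (f := f) hf.aestronglyMeasurable
      rw [hmp.map_eq] at h
      exact h.symm
    rwa [h2] at h1
  have h3 := HasSubgaussianMGF.measure_sum_ge_le_of_iIndepFun hind hsub
    (ε := ε * D) (by positivity)
  refine h3.trans_eq ?_
  congr 1
  have hD' : (0 : ℝ) < D := by exact_mod_cast hD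
  simp only [Finset.sum_const, Finset.card_univ, Fintype.card_fin, nsmul_eq_mul]
  push_cast
  norm_num
  field_simp
  ring

/-- Hoeffding's inequality for the empirical mean over the drawn frequencies. -/
theorem hoeffding_freqLaw (π : Measure (E d)) [IsProbabilityMeasure π] {f : E d → ℝ}
    (hf : Measurable f) (hb : ∀ x, |f x| ≤ 2) {ε : ℝ} (hε : 0 ≤ ε) {D : ℕ} (hD : 1 ≤ D) :
    freqLaw π D {ζ | ε ≤ |(∑ i, f (ζ i)) / D - ∫ x, f x ∂π|} ≤
      ENNReal.ofReal (2 * Real.exp (-(ε ^ 2 / 8 * D))) := by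
  have hD' : (0 : ℝ) < D := by exact_mod_cast hD
  have h1 := hoeffding_upper π hf hb hε D
  have h2 := hoeffding_upper π hf.neg (f := fun x => -f x) (by simpa using hb) hε D
  have hsub : {ζ : Fin D → E d | ε ≤ |(∑ i, f (ζ i)) / D - ∫ x, f x ∂π|} ⊆
      {ζ | ε * D ≤ ∑ i, (f (ζ i) - ∫ x, f x ∂π)} ∪
      {ζ | ε * D ≤ ∑ i, (-f (ζ i) - ∫ x, -f x ∂π)} := by
    intro ζ hζ
    simp only [Set.mem_ofPred_eq, Set.mem_union] at hζ ⊢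
    have e1 : ∑ i, (f (ζ i) - ∫ x, f x ∂π) = ((∑ i, f (ζ i)) / D - ∫ x, f x ∂π) * D := by
      simp [Finset.sum_sub_distrib]
      field_simp
    have e2 : ∑ i, (-f (ζ i) - ∫ x, -f x ∂π) = -((∑ i, f (ζ i)) / D - ∫ x, f x ∂π) * D := by
      rw [← neg_mul_eq_neg_mul, ← e1, integral_neg, ← Finset.sum_neg_distrib]
      exact Finset.sum_congr rfl fun _ _ => by ring
    rw [e1, e2]
    rcases le_abs.1 hζ with h | h
    · exact Or.inl (by gcongr)
    · exact Or.inr (by gcongr)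
  refine (measure_mono hsub).trans ((measure_union_le _ _).trans ?_)
  rw [two_mul, ENNReal.ofReal_add (Real.exp_pos _).le (Real.exp_pos _).le]
  exact add_le_add ((ENNReal.le_ofReal_iff_toReal_le (measure_ne_top _ _) (Real.exp_pos _).le).2 h1)
    ((ENNReal.le_ofReal_iff_toReal_le (measure_ne_top _ _) (Real.exp_pos _).le).2 h2)

/-- The envelope `min 2 (η ‖ζ‖)` of the oscillation of `cos ⟪ζ, ·⟫` over distance `η`. -/
noncomputable def cosEnvelope (η : ℝ) (ζ : E d) : ℝ := min 2 (η * ‖ζ‖)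

theorem measurable_cosEnvelope (η : ℝ) : Measurable (cosEnvelope (d := d) η) := by
  unfold cosEnvelope; fun_prop

theorem cosEnvelope_nonneg {η : ℝ} (hη : 0 ≤ η) (ζ : E d) : 0 ≤ cosEnvelope η ζ :=
  le_min zero_le_two (by positivity)

theorem abs_cosEnvelope_le {η : ℝ} (hη : 0 ≤ η) (ζ : E d) : |cosEnvelope η ζ| ≤ 2 := by
  rw [abs_of_nonneg (cosEnvelope_nonneg hη ζ)]
  exact min_le_left _ _

theorem integrable_cosEnvelope (π : Measure (E d)) [IsProbabilityMeasure π] {η : ℝ}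
    (hη : 0 ≤ η) : Integrable (cosEnvelope η) π :=
  Integrable.of_bound (measurable_cosEnvelope η).aestronglyMeasurable 2
    (Filter.Eventually.of_forall fun ζ => abs_cosEnvelope_le hη ζ)

theorem integrable_cos_inner (π : Measure (E d)) [IsProbabilityMeasure π] (z : E d) :
    Integrable (fun ζ : E d => Real.cos (inner ℝ ζ z)) π :=
  Integrable.of_bound (by fun_prop : Measurable _).aestronglyMeasurable 1
    (Filter.Eventually.of_forall fun ζ => Real.abs_cos_le_one _)

theorem abs_cos_inner_sub_le {η : ℝ} (ζ z z' : E d) (hz : ‖z - z'‖ ≤ η) :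
    |Real.cos (inner ℝ ζ z) - Real.cos (inner ℝ ζ z')| ≤ cosEnvelope η ζ := by
  refine le_min ?_ ?_
  · have h1 := abs_le.1 (Real.abs_cos_le_one (inner ℝ ζ z))
    have h2 := abs_le.1 (Real.abs_cos_le_one (inner ℝ ζ z'))
    exact abs_le.2 ⟨by linarith, by linarith⟩
  · have h1 : |Real.cos (inner ℝ ζ z) - Real.cos (inner ℝ ζ z')| ≤
        |inner ℝ ζ z - inner ℝ ζ z'| := by
      have := Real.lipschitzWith_cos.dist_le_mul (inner ℝ ζ z) (inner ℝ ζ z')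
      simpa [Real.dist_eq] using this
    refine h1.trans ?_
    rw [← inner_sub_right]
    refine (abs_real_inner_le_norm _ _).trans ?_
    rw [mul_comm]
    gcongr

/-- Truncation of the envelope at 2 permits dominated convergence, so no moment of `π` is required.
-/
theorem exists_integral_cosEnvelope_le (π : Measure (E d)) [IsProbabilityMeasure π] {δ : ℝ}
    (hδ : 0 < δ) : ∃ η : ℝ, 0 < η ∧ ∫ ζ, cosEnvelope η ζ ∂π ≤ δ := by
  have hlim : Filter.Tendsto (fun n : ℕ => ∫ ζ, cosEnvelope (1 / ((n : ℝ) + 1)) ζ ∂π)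
      Filter.atTop (nhds (∫ _ : E d, (0 : ℝ) ∂π)) := by
    refine tendsto_integral_of_dominated_convergence (fun _ => (2 : ℝ))
      (fun n => (measurable_cosEnvelope _).aestronglyMeasurable) (integrable_const _)
      (fun n => Filter.Eventually.of_forall fun ζ => abs_cosEnvelope_le (by positivity) ζ)
      (Filter.Eventually.of_forall fun ζ => ?_)
    have h1 : Filter.Tendsto (fun n : ℕ => 1 / ((n : ℝ) + 1) * ‖ζ‖) Filter.atTop (nhds 0) := by
      simpa using tendsto_one_div_add_atTop_nhds_zero_nat.mul_const ‖ζ‖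
    have h2 := (tendsto_const_nhds (x := (2 : ℝ))).min h1
    simpa [cosEnvelope] using h2
  rw [integral_zero] at hlim
  obtain ⟨n, hn⟩ := (hlim.eventually (gt_mem_nhds hδ)).exists
  exact ⟨1 / ((n : ℝ) + 1), by positivity, hn.le⟩

variable {κbar : E d → E d → ℝ} {π : Measure (E d)}

theorem IsStandardizedKernel.eq_integral_cos [IsProbabilityMeasure π]
    (hκ : IsStandardizedKernel κbar π)
    (s s' : E d) : κbar s s' = ∫ ζ, Real.cos (inner ℝ ζ (s - s')) ∂π := by
  have h := congrArg Complex.re (hκ.spectral s s')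
  rw [Complex.ofReal_re, charFun_apply] at h
  have hint : Integrable (fun x : E d => Complex.exp ((inner ℝ x (s - s') : ℝ) * Complex.I)) π :=
    Integrable.of_bound (by fun_prop : Measurable _).aestronglyMeasurable 1
      (Filter.Eventually.of_forall fun ζ => by rw [Complex.norm_exp_ofReal_mul_I])
  have h2 := integral_re hint
  simp only [RCLike.re_eq_complex_re, Complex.exp_ofReal_mul_I_re] at h2
  rw [h, ← h2]

theorem IsStandardizedKernel.one_sub_le [IsProbabilityMeasure π]
    (hκ : IsStandardizedKernel κbar π) {η : ℝ}
    {s s' : E d} (h : ‖s - s'‖ ≤ η) : 1 - κbar s s' ≤ ∫ ζ, cosEnvelope η ζ ∂π := by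
  have hη : 0 ≤ η := (norm_nonneg _).trans h
  rw [hκ.eq_integral_cos]
  have h1 : (1 : ℝ) = ∫ _ : E d, (1 : ℝ) ∂π := by simp
  conv_lhs => rw [h1]
  rw [← integral_sub (integrable_const _) (integrable_cos_inner π _)]
  refine integral_mono ((integrable_const _).sub (integrable_cos_inner π _))
    (integrable_cosEnvelope π hη) fun ζ => ?_
  have := abs_cos_inner_sub_le ζ 0 (s - s') (η := η) (by simpa [norm_sub_rev] using h)
  simp only [inner_zero_right, Real.cos_zero] at this
  exact (le_abs_self _).trans this

/-- Each sine–cosine pair collapses by the subtraction formula, making the feature kernel an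
empirical mean of bounded functions of the frequencies. -/
theorem feature_dotProduct {D : ℕ} (ζ : Fin D → E d) (s s' : E d) :
    feature ζ s ⬝ᵥ feature ζ s' = (∑ i, Real.cos (inner ℝ (ζ i) (s - s'))) / D := by
  simp only [dotProduct, feature, Fintype.sum_prod_type, Fin.sum_univ_two]
  rw [Finset.sum_div]
  refine Finset.sum_congr rfl fun i _ => ?_
  rw [inner_sub_right, Real.cos_sub]
  have : (1 / √(D : ℝ)) * (1 / √(D : ℝ)) = 1 / D := by
    rw [div_mul_div_comm, one_mul, Real.mul_self_sqrt (Nat.cast_nonneg D)]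
  simp only [if_true, one_ne_zero, if_false]
  linear_combination (Real.sin (inner ℝ (ζ i) s) * Real.sin (inner ℝ (ζ i) s') +
    Real.cos (inner ℝ (ζ i) s) * Real.cos (inner ℝ (ζ i) s')) * this

theorem feature_dotProduct_self {D : ℕ} (hD : 1 ≤ D) (ζ : Fin D → E d) (s : E d) :
    feature ζ s ⬝ᵥ feature ζ s = 1 := by
  have hD' : (D : ℝ) ≠ 0 := by positivity
  simp [feature_dotProduct, hD']

theorem abs_feature_dotProduct_le {D : ℕ} (hD : 1 ≤ D) (ζ : Fin D → E d) (s s' : E d) :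
    |feature ζ s ⬝ᵥ feature ζ s'| ≤ 1 := by
  refine abs_le_one_iff_mul_self_le_one.2 ?_
  have := dotProduct_sq_le (feature ζ s) (feature ζ s')
  rw [feature_dotProduct_self hD, feature_dotProduct_self hD] at this
  nlinarith

/-- The random-feature kernel is uniformly close to `κbar` on a bounded set, except with
probability exponentially small in the number of features. -/
theorem uniform_kernel_concentration [IsProbabilityMeasure π]
    (hκ : IsStandardizedKernel κbar π) {S : Set (E d)} (hS : Bornology.IsBounded S)
    {δ : ℝ} (hδ : 0 < δ) :
    ∃ A c : ℝ, 0 < A ∧ 0 < c ∧ ∀ D : ℕ, 1 ≤ D →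
      freqLaw π D {ζ | ¬ ∀ s ∈ S, ∀ s' ∈ S, |feature ζ s ⬝ᵥ feature ζ s' - κbar s s'| ≤ δ} ≤
        ENNReal.ofReal (A * Real.exp (-(c * D))) := by
  -- Four errors of size `δ / 4`: the envelope's mean enters twice, the deviation of its empirical
  -- mean once, and the deviation at a net point once.
  obtain ⟨η, hη, hηδ⟩ := exists_integral_cosEnvelope_le π (δ := δ / 4) (by positivity)
  -- Both kernels depend only on `s - s'`, so a net of the difference set suffices.
  have htb : TotallyBounded (S - S) :=
    (Bornology.IsBounded.sub hS hS).isCompact_closure.totallyBounded.subset subset_closure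
  obtain ⟨N, hN, hcov⟩ := Metric.totallyBounded_iff.1 htb η hη
  lift N to Finset (E d) using hN
  refine ⟨2 * (N.card + 1), (δ / 4) ^ 2 / 8, by positivity, by positivity, fun D hD => ?_⟩
  have hD' : (0 : ℝ) < D := by exact_mod_cast hD
  set B0 : Set (Fin D → E d) :=
    {ζ | δ / 4 ≤ |(∑ i, cosEnvelope η (ζ i)) / D - ∫ x, cosEnvelope η x ∂π|}
  set Bz : E d → Set (Fin D → E d) := fun z =>
    {ζ | δ / 4 ≤ |(∑ i, Real.cos (inner ℝ (ζ i) z)) / D - ∫ x, Real.cos (inner ℝ x z) ∂π|}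
  have hsub : {ζ : Fin D → E d | ¬ ∀ s ∈ S, ∀ s' ∈ S,
      |feature ζ s ⬝ᵥ feature ζ s' - κbar s s'| ≤ δ} ⊆ B0 ∪ ⋃ z ∈ N, Bz z := by
    intro ζ
    contrapose
    intro hζ
    simp only [Set.mem_union, Set.mem_iUnion, not_or, not_exists, B0, Bz, Set.mem_ofPred_eq,
      not_le] at hζ
    obtain ⟨h0, hz⟩ := hζ
    rw [Set.mem_ofPred_eq, not_not]
    intro s hs s' hs'
    obtain ⟨z, hzN, hzs⟩ : ∃ z ∈ N, ‖(s - s') - z‖ ≤ η := by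
      have := hcov (Set.sub_mem_sub hs hs')
      simp only [Set.mem_iUnion, Metric.mem_ball, exists_prop] at this
      obtain ⟨z, hz, hd⟩ := this
      exact ⟨z, hz, by rw [← dist_eq_norm]; exact hd.le⟩
    have hzz := hz z hzN
    rw [feature_dotProduct, hκ.eq_integral_cos]
    have hemp : |(∑ i, Real.cos (inner ℝ (ζ i) (s - s'))) / D -
        (∑ i, Real.cos (inner ℝ (ζ i) z)) / D| ≤ (∑ i, cosEnvelope η (ζ i)) / D := by
      rw [← sub_div, abs_div, abs_of_pos hD', ← Finset.sum_sub_distrib]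
      gcongr
      exact (Finset.abs_sum_le_sum_abs _ _).trans
        (Finset.sum_le_sum fun i _ => abs_cos_inner_sub_le _ _ _ hzs)
    have hexp : |∫ x, Real.cos (inner ℝ x (s - s')) ∂π - ∫ x, Real.cos (inner ℝ x z) ∂π| ≤
        ∫ x, cosEnvelope η x ∂π := by
      rw [← integral_sub (integrable_cos_inner π _) (integrable_cos_inner π _)]
      refine (abs_integral_le_integral_abs).trans ?_
      exact integral_mono ((integrable_cos_inner π _).sub (integrable_cos_inner π _)).abs
        (integrable_cosEnvelope π hη.le) fun ζ => abs_cos_inner_sub_le _ _ _ hzs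
    rw [abs_lt] at h0 hzz
    rw [abs_le] at hemp hexp ⊢
    constructor <;> linarith
  refine (measure_mono hsub).trans ((measure_union_le _ _).trans ?_)
  have hB0 : freqLaw π D B0 ≤ ENNReal.ofReal (2 * Real.exp (-((δ / 4) ^ 2 / 8 * D))) :=
    hoeffding_freqLaw π (measurable_cosEnvelope η) (abs_cosEnvelope_le hη.le) (by positivity) hD
  have hBz : ∀ z ∈ N, freqLaw π D (Bz z) ≤
      ENNReal.ofReal (2 * Real.exp (-((δ / 4) ^ 2 / 8 * D))) := fun z _ =>
    hoeffding_freqLaw π (f := fun x => Real.cos (inner ℝ x z)) (by fun_prop)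
      (fun x => (Real.abs_cos_le_one _).trans one_le_two) (by positivity) hD
  have hun : freqLaw π D (⋃ z ∈ N, Bz z) ≤
      N.card * ENNReal.ofReal (2 * Real.exp (-((δ / 4) ^ 2 / 8 * D))) := by
    refine (measure_biUnion_finset_le _ _).trans ?_
    refine (Finset.sum_le_sum hBz).trans ?_
    rw [Finset.sum_const, nsmul_eq_mul]
  refine (add_le_add hB0 hun).trans ?_
  rw [← ENNReal.ofReal_natCast, ← ENNReal.ofReal_mul (Nat.cast_nonneg _),
    ← ENNReal.ofReal_add (by positivity) (by positivity)]
  refine ENNReal.ofReal_le_ofReal (le_of_eq ?_)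
  ring

/-- A bounded set has finite nets in the metric of the kernel. -/
theorem exists_finset_kernel_net [IsProbabilityMeasure π] (hκ : IsStandardizedKernel κbar π)
    {S : Set (E d)} (hS : Bornology.IsBounded S) {δ : ℝ} (hδ : 0 < δ) :
    ∃ F : Finset S, ∀ s : S, ∃ f ∈ F, 1 - κbar s f ≤ δ := by
  obtain ⟨η, hη, hηδ⟩ := exists_integral_cosEnvelope_le π hδ
  obtain ⟨N, hNS, hN, hcov⟩ := Metric.finite_approx_of_totallyBounded
    (hS.isCompact_closure.totallyBounded.subset subset_closure) η hη
  have hfin : (Subtype.val ⁻¹' N : Set S).Finite := hN.preimage Subtype.val_injective.injOn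
  refine ⟨hfin.toFinset, fun s => ?_⟩
  have hs := hcov s.2
  simp only [Set.mem_iUnion, Metric.mem_ball, exists_prop] at hs
  obtain ⟨f, hf, hd⟩ := hs
  refine ⟨⟨f, hNS hf⟩, by simpa using hf, (hκ.one_sub_le ?_).trans hηδ⟩
  rw [← dist_eq_norm]
  exact hd.le

end Concentration

/-! ### Finite kernel expansions, uniform over a ball of the RKHS. -/

section KernelExpansion

variable {d : ℕ} {S : Set (E d)} {κbar : E d → E d → ℝ} {π : Measure (E d)} {σθ : ℝ}
  {H : Type*} [NormedAddCommGroup H] [InnerProductSpace ℝ H] [CompleteSpace H] [RKHS ℝ H S ℝ]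

theorem apply_eq_inner_kerFun (v : H) (s : S) : v s = inner ℝ (RKHS.kerFun H s (1 : ℝ)) v := by
  rw [RKHS.kerFun_inner]
  simp

theorem inner_kerFun_kerFun (hH : ∀ s s' : S, RKHS.kernel H s s' 1 = σθ ^ 2 * κbar s s')
    (s s' : S) :
    inner ℝ (RKHS.kerFun H s (1 : ℝ)) (RKHS.kerFun H s' (1 : ℝ)) = σθ ^ 2 * κbar s s' := by
  rw [← apply_eq_inner_kerFun, RKHS.kerFun_apply, hH]

theorem norm_kerFun_sub_sq (hκ : IsStandardizedKernel κbar π)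
    (hH : ∀ s s' : S, RKHS.kernel H s s' 1 = σθ ^ 2 * κbar s s') (s s' : S) :
    ‖RKHS.kerFun H s (1 : ℝ) - RKHS.kerFun H s' (1 : ℝ)‖ ^ 2 =
      2 * σθ ^ 2 * (1 - κbar s s') := by
  rw [norm_sub_sq_real, ← real_inner_self_eq_norm_sq, ← real_inner_self_eq_norm_sq,
    inner_kerFun_kerFun hH, inner_kerFun_kerFun hH, inner_kerFun_kerFun hH, hκ.standardized,
    hκ.standardized]
  ring

theorem abs_apply_le_norm (hκ : IsStandardizedKernel κbar π) (hσθ : 0 < σθ)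
    (hH : ∀ s s' : S, RKHS.kernel H s s' 1 = σθ ^ 2 * κbar s s') (v : H) (s : S) :
    |v s| ≤ σθ * ‖v‖ := by
  have hk : ‖RKHS.kerFun H s (1 : ℝ)‖ = σθ := by
    rw [norm_eq_sqrt_real_inner, inner_kerFun_kerFun hH, hκ.standardized, mul_one,
      Real.sqrt_sq hσθ.le]
  rw [apply_eq_inner_kerFun]
  refine (abs_real_inner_le_norm _ _).trans_eq ?_
  rw [hk]

/-- Elements of a ball of the RKHS are uniformly approximated by kernel expansions on a fixed
finite set of centres, with bounded coefficients. -/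
theorem exists_kernel_expansion [IsProbabilityMeasure π] (hκ : IsStandardizedKernel κbar π)
    (hS : Bornology.IsBounded S) (hσθ : 0 < σθ)
    (hH : ∀ s s' : S, RKHS.kernel H s s' 1 = σθ ^ 2 * κbar s s') (C : ℝ) {δ : ℝ} (hδ : 0 < δ) :
    ∃ (F : Finset S) (M : ℝ), 0 ≤ M ∧ ∀ v : H, ‖v‖ ≤ C → ∃ α : F → ℝ,
      ∑ f, |α f| ≤ M ∧ ∀ s : S, |v s - ∑ f, α f * (σθ ^ 2 * κbar s f.1)| ≤ δ := by
  set ω : ℝ := δ / (|C| + 1) with hω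
  have hωpos : 0 < ω := by positivity
  obtain ⟨F, hF⟩ := exists_finset_kernel_net hκ hS (δ := ω ^ 2 / (2 * σθ ^ 2)) (by positivity)
  set L : (F → ℝ) →ₗ[ℝ] H := Fintype.linearCombination ℝ
    (fun f : F => RKHS.kerFun H f.1 (1 : ℝ)) with hL
  set V := L.range
  -- A linear right inverse selects coefficients even if the kernel sections are dependent; being
  -- continuous on the finite-dimensional `V`, it bounds them uniformly.
  obtain ⟨g, hg⟩ : ∃ g : V →ₗ[ℝ] (F → ℝ), L.rangeRestrict ∘ₗ g = LinearMap.id := LinearMap.exists_rightInverse_of_surjective L.rangeRestrict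
    L.range_rangeRestrict
  set G : V →L[ℝ] (F → ℝ) := LinearMap.toContinuousLinearMap g with hG
  refine ⟨F, Fintype.card F * (‖G‖ * |C|), by positivity, fun v hv => ?_⟩
  have hvC : ‖v‖ ≤ |C| := hv.trans (le_abs_self C)
  set w : V := V.orthogonalProjectionOnto v with hw
  have hLw : L (g w) = w := by
    have := LinearMap.congr_fun hg w
    simpa using congrArg Subtype.val this
  have hwle : ‖w‖ ≤ ‖v‖ := V.norm_orthogonalProjectionOnto_apply_le v
  refine ⟨g w, ?_, fun s => ?_⟩
  · have hterm : ∀ f : F, |g w f| ≤ ‖G‖ * |C| := fun f => by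
      calc |g w f| = ‖G w f‖ := rfl
        _ ≤ ‖G w‖ := norm_le_pi_norm _ _
        _ ≤ ‖G‖ * ‖w‖ := G.le_opNorm w
        _ ≤ ‖G‖ * |C| := by gcongr; exact hwle.trans hvC
    refine (Finset.sum_le_sum fun f _ => hterm f).trans_eq ?_
    simp
  · have hexp : ∑ f, g w f * (σθ ^ 2 * κbar s f.1) =
        inner ℝ (RKHS.kerFun H s (1 : ℝ)) (w : H) := by
      rw [← hLw, hL, Fintype.linearCombination_apply, inner_sum]
      refine Finset.sum_congr rfl fun f _ => ?_
      rw [inner_smul_right, inner_kerFun_kerFun hH]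
    obtain ⟨f, hfF, hf⟩ := hF s
    -- The projection residual vanishes at the centres, so its value at `s` only sees the distance
    -- from the section at `s` to that at a nearby centre.
    have horth : inner ℝ (RKHS.kerFun H f (1 : ℝ)) (v - w) = 0 := by
      have hmem : RKHS.kerFun H f (1 : ℝ) ∈ V := by
        refine ⟨Pi.single ⟨f, hfF⟩ 1, ?_⟩
        rw [hL, Fintype.linearCombination_apply_single]
        simp
      exact Submodule.inner_right_of_mem_orthogonal hmem
        (V.sub_starProjection_mem_orthogonal v)
    have hres : ‖v - (w : H)‖ ≤ |C| := by
      have h1 : inner ℝ (w : H) (v - w) = 0 :=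
        Submodule.inner_right_of_mem_orthogonal w.2 (V.sub_starProjection_mem_orthogonal v)
      have h2 : ‖v‖ ^ 2 = ‖(w : H)‖ ^ 2 + ‖v - (w : H)‖ ^ 2 := by
        have h3 := norm_add_sq_real (w : H) (v - w)
        rw [h1] at h3
        simpa using h3
      refine le_trans ?_ hvC
      exact abs_le_of_sq_le_sq' (by nlinarith [sq_nonneg ‖(w : H)‖]) (norm_nonneg v) |>.2
    have hker : ‖RKHS.kerFun H s (1 : ℝ) - RKHS.kerFun H f (1 : ℝ)‖ ≤ ω := by
      refine abs_le_of_sq_le_sq' ?_ hωpos.le |>.2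
      rw [norm_kerFun_sub_sq hκ hH]
      rw [le_div_iff₀ (by positivity)] at hf
      linarith
    rw [hexp, apply_eq_inner_kerFun, ← inner_sub_right,
      show inner ℝ (RKHS.kerFun H s (1 : ℝ)) (v - w) =
        inner ℝ (RKHS.kerFun H s (1 : ℝ) - RKHS.kerFun H f (1 : ℝ)) (v - w) by
          rw [inner_sub_left, horth, sub_zero]]
    refine (abs_real_inner_le_norm _ _).trans ?_
    calc _ ≤ ω * |C| := by gcongr
      _ ≤ ω * (|C| + 1) := by gcongr; linarith
      _ = δ := by rw [hω]; field_simp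

end KernelExpansion

/-! ### Passing between prediction errors and Bellman errors. -/

section DiscountedErrors

/-- A sequence of at most linear growth is bounded by its discounted differences. -/
theorem abs_le_of_abs_sub_discounted_le {γ : ℝ} (hγ0 : 0 ≤ γ) (hγ1 : γ < 1) {u : ℕ → ℝ}
    {W a b : ℝ} (hW : ∀ t, |u t - γ * u (t + 1)| ≤ W) (hu : ∀ t : ℕ, |u t| ≤ a + b * t) (t : ℕ) :
    |u t| ≤ W / (1 - γ) := by
  have hγ' : 0 < 1 - γ := by linarith
  have hW0 : 0 ≤ W := (abs_nonneg _).trans (hW 0)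
  -- Iterating the recursion `n` times; geometric decay then beats linear growth.
  have hstep : ∀ n : ℕ, ∀ t, |u t| ≤ W / (1 - γ) + γ ^ n * |u (t + n)| := by
    intro n
    induction n with
    | zero => intro t; simp; positivity
    | succ n ih =>
      intro t
      have h1 : |u t| ≤ W + γ * |u (t + 1)| := by
        calc |u t| = |(u t - γ * u (t + 1)) + γ * u (t + 1)| := by ring_nf
          _ ≤ |u t - γ * u (t + 1)| + |γ * u (t + 1)| := abs_add_le _ _
          _ ≤ W + γ * |u (t + 1)| := by
            rw [abs_mul, abs_of_nonneg hγ0]; linarith [hW t]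
      have h2 := mul_le_mul_of_nonneg_left (ih (t + 1)) hγ0
      rw [show t + 1 + n = t + (n + 1) by ring] at h2
      calc |u t| ≤ W + γ * (W / (1 - γ) + γ ^ n * |u (t + (n + 1))|) := by linarith
        _ = W / (1 - γ) + γ ^ (n + 1) * |u (t + (n + 1))| := by
          field_simp
          ring
  have hlim : Filter.Tendsto
      (fun n : ℕ => W / (1 - γ) + ((a + b * t) * γ ^ n + b * (n * γ ^ n))) Filter.atTop
      (nhds (W / (1 - γ) + ((a + b * t) * 0 + b * 0))) :=
    tendsto_const_nhds.add
      (((tendsto_pow_atTop_nhds_zero_of_lt_one hγ0 hγ1).const_mul _).add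
        ((tendsto_self_mul_const_pow_of_lt_one hγ0 hγ1).const_mul _))
  simp only [mul_zero, add_zero] at hlim
  refine ge_of_tendsto' hlim fun n => (hstep n t).trans ?_
  have h3 := mul_le_mul_of_nonneg_left (hu (t + n)) (pow_nonneg hγ0 n)
  push_cast at h3
  linarith

/-- By convexity of the square, `u t` being the average of `(u t - γ * u (t + 1)) / (1 - γ)` and `u
(t + 1)` with weights `1 - γ` and `γ`. Summation shifts the index and leaves only a boundary term.
-/
theorem sum_sq_le_sum_sq_sub_discounted {γ : ℝ} (hγ0 : 0 ≤ γ) (hγ1 : γ < 1) (u : ℕ → ℝ) (T : ℕ) :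
    ∑ t ∈ Finset.range T, u t ^ 2 ≤
      1 / (1 - γ) ^ 2 * ∑ t ∈ Finset.range T, (u t - γ * u (t + 1)) ^ 2 +
        γ / (1 - γ) * u T ^ 2 := by
  have hγ' : 0 < 1 - γ := by linarith
  have hterm : ∀ t ∈ Finset.range T,
      (1 - γ) * u t ^ 2 ≤ (u t - γ * u (t + 1)) ^ 2 + (1 - γ) * (γ * u (t + 1) ^ 2) := by
    intro t _
    nlinarith [mul_nonneg hγ0 (sq_nonneg (u t - u (t + 1)))]
  have hsum := Finset.sum_le_sum hterm
  rw [Finset.sum_add_distrib, ← Finset.mul_sum, ← Finset.mul_sum, ← Finset.mul_sum] at hsum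
  have hshift : ∑ t ∈ Finset.range T, u (t + 1) ^ 2 + u 0 ^ 2 =
      ∑ t ∈ Finset.range T, u t ^ 2 + u T ^ 2 := by
    rw [← Finset.sum_range_succ' (fun t => u t ^ 2), Finset.sum_range_succ]
  set A := ∑ t ∈ Finset.range T, u t ^ 2
  set B := ∑ t ∈ Finset.range T, (u t - γ * u (t + 1)) ^ 2
  set A' := ∑ t ∈ Finset.range T, u (t + 1) ^ 2
  have hA' : A' ≤ A + u T ^ 2 := by nlinarith [sq_nonneg (u 0)]
  have h1 : (1 - γ) ^ 2 * A ≤ B + (1 - γ) * γ * u T ^ 2 := by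
    nlinarith [mul_le_mul_of_nonneg_left hA' (mul_nonneg hγ'.le hγ0)]
  have h2 : A ≤ (B + (1 - γ) * γ * u T ^ 2) / (1 - γ) ^ 2 := by
    rw [le_div_iff₀ (by positivity)]; linarith
  refine h2.trans_eq ?_
  field_simp

theorem sum_sq_sub_discounted_le {γ : ℝ} (hγ0 : 0 ≤ γ) (u : ℕ → ℝ) (T : ℕ) :
    ∑ t ∈ Finset.range T, (u t - γ * u (t + 1)) ^ 2 ≤
      (1 + γ) ^ 2 * ∑ t ∈ Finset.range T, u t ^ 2 + γ * (1 + γ) * u T ^ 2 := by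
  have hterm : ∀ t ∈ Finset.range T,
      (u t - γ * u (t + 1)) ^ 2 ≤ (1 + γ) * u t ^ 2 + (γ * (1 + γ)) * u (t + 1) ^ 2 := by
    intro t _
    nlinarith [mul_nonneg hγ0 (sq_nonneg (u t + u (t + 1)))]
  have hsum := Finset.sum_le_sum hterm
  rw [Finset.sum_add_distrib, ← Finset.mul_sum, ← Finset.mul_sum] at hsum
  have hshift : ∑ t ∈ Finset.range T, u (t + 1) ^ 2 + u 0 ^ 2 =
      ∑ t ∈ Finset.range T, u t ^ 2 + u T ^ 2 := by
    rw [← Finset.sum_range_succ' (fun t => u t ^ 2), Finset.sum_range_succ]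
  have hA' : ∑ t ∈ Finset.range T, u (t + 1) ^ 2 ≤
      ∑ t ∈ Finset.range T, u t ^ 2 + u T ^ 2 := by nlinarith [sq_nonneg (u 0)]
  have := mul_le_mul_of_nonneg_left hA' (by positivity : 0 ≤ γ * (1 + γ))
  nlinarith

/-- Comparison of the squared prediction errors of recursive least squares on temporal-difference
regressors with those of a fixed predictor that is close to a linear one. -/
theorem IsRLS.sum_sq_error_le {ι : Type*} [Fintype ι] [DecidableEq ι] {γ σn σθ : ℝ}
    (hγ0 : 0 ≤ γ) (hγ1 : γ < 1) (hσn : 0 < σn) (hσθ : 0 < σθ) {f : ℕ → ι → ℝ} {r : ℕ → ℝ}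
    {θ : ℕ → ι → ℝ} {S : ℕ → Matrix ι ι ℝ}
    (H : IsRLS σn σθ (fun t => f t - γ • f (t + 1)) r θ S) (hf : ∀ t, f t ⬝ᵥ f t ≤ 1)
    {Be : ℝ} (hb : ∀ t, |r (t + 1) - (f (t + 1) - γ • f (t + 2)) ⬝ᵥ θ t| ≤ Be)
    {V v : ℕ → ℝ} (hV : ∀ t, V (t + 1) = r (t + 1) + γ * V (t + 2))
    {R R' : ℝ} (hVb : ∀ t, |V (t + 1)| ≤ R) (hvb : ∀ t, |v (t + 1)| ≤ R')
    (hvB : ∀ t, |r (t + 1) - v (t + 1) + γ * v (t + 2)| ≤ Be)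
    {w : ι → ℝ} {δ M : ℝ} (hw : w ⬝ᵥ w ≤ M) (hvw : ∀ t, |v (t + 1) - f (t + 1) ⬝ᵥ w| ≤ δ)
    {T : ℕ} {P : ℝ} (hP : ∑ t ∈ Finset.range T, (f (t + 1) - γ • f (t + 2)) ⬝ᵥ
        (S t *ᵥ (f (t + 1) - γ • f (t + 2))) / ((f (t + 1) - γ • f (t + 2)) ⬝ᵥ
          (S t *ᵥ (f (t + 1) - γ • f (t + 2))) + σn ^ 2) ≤ P) :
    ∑ t ∈ Finset.range T, (f (t + 1) ⬝ᵥ θ t - V (t + 1)) ^ 2 ≤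
      2 / (1 - γ) ^ 2 * ((1 + γ) ^ 2 * ∑ t ∈ Finset.range T, (v (t + 1) - V (t + 1)) ^ 2 +
        γ * (1 + γ) * (Be / (1 - γ)) ^ 2 + (4 * δ * Be + 4 * δ ^ 2) * T +
        σn ^ 2 / σθ ^ 2 * M + Be ^ 2 * (1 + σθ ^ 2 / σn ^ 2) * P) +
      γ / (1 - γ) * ((Be + Be * σθ / σn) / (1 - γ)) ^ 2 := by
  have hγ' : 0 < 1 - γ := by linarith
  have hBe : 0 ≤ Be := (abs_nonneg _).trans (hb 0)
  have hδ : 0 ≤ δ := (abs_nonneg _).trans (hvw 0)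
  set u : ℕ → ℝ := fun t => f (t + 1) ⬝ᵥ θ t - V (t + 1) with hu
  set z : ℕ → ℝ := fun t => v (t + 1) - V (t + 1) with hz
  set b : ℕ → ℝ := fun t => r (t + 1) - (f (t + 1) - γ • f (t + 2)) ⬝ᵥ θ t with hbdef
  set g : ℕ → ℝ := fun t => f (t + 2) ⬝ᵥ (θ (t + 1) - θ t) with hg
  -- `u t` uses `θ t` but `u (t + 1)` uses `θ (t + 1)`; the mismatch is the drift `g t`.
  have hud : ∀ t, u t - γ * u (t + 1) = -b t - γ * g t := by
    intro t
    simp only [hu, hbdef, hg, hV t, sub_dotProduct, smul_dotProduct, dotProduct_sub, smul_eq_mul]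
    ring
  have hgabs : ∀ t, |g t| ≤ Be * σθ / σn := fun t =>
    H.abs_update_le hσn hσθ t (hb t) _ (hf (t + 2))
  have hgsq : ∀ t, g t ^ 2 ≤ Be ^ 2 * σθ ^ 2 / σn ^ 2 * ((f (t + 1) - γ • f (t + 2)) ⬝ᵥ
        (S t *ᵥ (f (t + 1) - γ • f (t + 2))) / ((f (t + 1) - γ • f (t + 2)) ⬝ᵥ
          (S t *ᵥ (f (t + 1) - γ • f (t + 2))) + σn ^ 2)) := fun t =>
    H.sq_update_le hσn hσθ t (hb t) _ (hf (t + 2))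
  -- the online errors are bounded
  have hgrow : ∀ t : ℕ, ∀ x : ι → ℝ, x ⬝ᵥ x ≤ 1 → |x ⬝ᵥ θ t| ≤ Be * σθ / σn * t := by
    intro t x hx
    induction t with
    | zero => simp [H.mean_zero]
    | succ t ih =>
      have h1 : |x ⬝ᵥ (θ (t + 1) - θ t)| ≤ Be * σθ / σn := H.abs_update_le hσn hσθ t (hb t) x hx
      have h2 : x ⬝ᵥ θ (t + 1) = x ⬝ᵥ θ t + x ⬝ᵥ (θ (t + 1) - θ t) := by
        rw [dotProduct_sub]; ring
      rw [h2]
      refine (abs_add_le _ _).trans ?_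
      push_cast
      linarith
  have hubd : |u T| ≤ (Be + Be * σθ / σn) / (1 - γ) := by
    refine abs_le_of_abs_sub_discounted_le hγ0 hγ1 (a := R) (b := Be * σθ / σn) ?_ ?_ T
    · intro t
      rw [hud]
      have h1 : |γ * g t| ≤ Be * σθ / σn := by
        rw [abs_mul, abs_of_nonneg hγ0]
        nlinarith [hgabs t, abs_nonneg (g t)]
      calc |-b t - γ * g t| ≤ |-b t| + |γ * g t| := abs_sub _ _
        _ ≤ _ := by rw [abs_neg]; exact add_le_add (hb t) h1
    · intro t
      refine (abs_sub _ _).trans ?_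
      linarith [hgrow t _ (hf (t + 1)), hVb t]
  have hzd : ∀ t, z t - γ * z (t + 1) = -(r (t + 1) - v (t + 1) + γ * v (t + 2)) := by
    intro t
    simp only [hz, hV t]
    ring
  have hzbd : |z T| ≤ Be / (1 - γ) := by
    refine abs_le_of_abs_sub_discounted_le hγ0 hγ1 (a := R' + R) (b := 0) ?_ ?_ T
    · intro t
      rw [hzd, abs_neg]
      exact hvB t
    · intro t
      refine (abs_sub _ _).trans ?_
      linarith [hvb t, hVb t]
  have hu2 : u T ^ 2 ≤ ((Be + Be * σθ / σn) / (1 - γ)) ^ 2 :=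
    sq_le_sq' (abs_le.1 hubd).1 (abs_le.1 hubd).2
  have hz2 : z T ^ 2 ≤ (Be / (1 - γ)) ^ 2 := sq_le_sq' (abs_le.1 hzbd).1 (abs_le.1 hzbd).2
  -- Bellman errors of the fixed predictor and of its linear approximation
  have hfix : ∑ t ∈ Finset.range T, (r (t + 1) - v (t + 1) + γ * v (t + 2)) ^ 2 ≤
      (1 + γ) ^ 2 * ∑ t ∈ Finset.range T, z t ^ 2 + γ * (1 + γ) * (Be / (1 - γ)) ^ 2 := by
    have h1 := sum_sq_sub_discounted_le hγ0 z T
    simp only [hzd, neg_sq] at h1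
    have := mul_le_mul_of_nonneg_left hz2 (by positivity : 0 ≤ γ * (1 + γ))
    linarith
  have hlin : ∑ t ∈ Finset.range T, (r (t + 1) - (f (t + 1) - γ • f (t + 2)) ⬝ᵥ w) ^ 2 ≤
      ∑ t ∈ Finset.range T, (r (t + 1) - v (t + 1) + γ * v (t + 2)) ^ 2 +
        (4 * δ * Be + 4 * δ ^ 2) * T := by
    have hterm : ∀ t ∈ Finset.range T, (r (t + 1) - (f (t + 1) - γ • f (t + 2)) ⬝ᵥ w) ^ 2 ≤
        (r (t + 1) - v (t + 1) + γ * v (t + 2)) ^ 2 + (4 * δ * Be + 4 * δ ^ 2) := by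
      intro t _
      have h1 : r (t + 1) - (f (t + 1) - γ • f (t + 2)) ⬝ᵥ w =
          (r (t + 1) - v (t + 1) + γ * v (t + 2)) +
          ((v (t + 1) - f (t + 1) ⬝ᵥ w) - γ * (v (t + 2) - f (t + 2) ⬝ᵥ w)) := by
        simp only [sub_dotProduct, smul_dotProduct, smul_eq_mul]
        ring
      have h2 : |(v (t + 1) - f (t + 1) ⬝ᵥ w) - γ * (v (t + 2) - f (t + 2) ⬝ᵥ w)| ≤ 2 * δ := by
        refine (abs_sub _ _).trans ?_
        rw [abs_mul, abs_of_nonneg hγ0]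
        nlinarith [hvw t, hvw (t + 1), abs_nonneg (v (t + 2) - f (t + 2) ⬝ᵥ w)]
      rw [h1]
      set x := r (t + 1) - v (t + 1) + γ * v (t + 2)
      set y := (v (t + 1) - f (t + 1) ⬝ᵥ w) - γ * (v (t + 2) - f (t + 2) ⬝ᵥ w)
      have h3 : x * y ≤ Be * (2 * δ) := by
        refine (le_abs_self _).trans ?_
        rw [abs_mul]
        exact mul_le_mul (hvB t) h2 (abs_nonneg _) hBe
      have h4 : y ^ 2 ≤ (2 * δ) ^ 2 := sq_le_sq' (abs_le.1 h2).1 (abs_le.1 h2).2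
      nlinarith
    refine (Finset.sum_le_sum hterm).trans_eq ?_
    rw [Finset.sum_add_distrib, Finset.sum_const, Finset.card_range, nsmul_eq_mul]
    ring
  have hreg : ∑ t ∈ Finset.range T, b t ^ 2 ≤
      ∑ t ∈ Finset.range T, (r (t + 1) - (f (t + 1) - γ • f (t + 2)) ⬝ᵥ w) ^ 2 +
        σn ^ 2 / σθ ^ 2 * M + Be ^ 2 * P := by
    refine (H.sum_sq_residual_le hσn hσθ w T (fun t _ => hb t)).trans ?_
    gcongr
  have hgsum : ∑ t ∈ Finset.range T, g t ^ 2 ≤ Be ^ 2 * σθ ^ 2 / σn ^ 2 * P := by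
    refine (Finset.sum_le_sum fun t _ => hgsq t).trans ?_
    rw [← Finset.mul_sum]
    gcongr
  -- Separating residual from drift produces the factor 2 of the final constant.
  have hx : ∑ t ∈ Finset.range T, (u t - γ * u (t + 1)) ^ 2 ≤
      2 * ∑ t ∈ Finset.range T, b t ^ 2 + 2 * ∑ t ∈ Finset.range T, g t ^ 2 := by
    rw [Finset.mul_sum, Finset.mul_sum, ← Finset.sum_add_distrib]
    refine Finset.sum_le_sum fun t _ => ?_
    rw [hud]
    have hγ2 : γ ^ 2 ≤ 1 := pow_le_one₀ hγ0 hγ1.le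
    nlinarith [sq_nonneg (b t - γ * g t), mul_le_mul_of_nonneg_right hγ2 (sq_nonneg (g t))]
  calc ∑ t ∈ Finset.range T, u t ^ 2
      ≤ 1 / (1 - γ) ^ 2 * ∑ t ∈ Finset.range T, (u t - γ * u (t + 1)) ^ 2 +
        γ / (1 - γ) * u T ^ 2 := sum_sq_le_sum_sq_sub_discounted hγ0 hγ1 u T
    _ ≤ 1 / (1 - γ) ^ 2 * (2 * ((1 + γ) ^ 2 * ∑ t ∈ Finset.range T, z t ^ 2 +
        γ * (1 + γ) * (Be / (1 - γ)) ^ 2 + (4 * δ * Be + 4 * δ ^ 2) * T +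
        σn ^ 2 / σθ ^ 2 * M + Be ^ 2 * (1 + σθ ^ 2 / σn ^ 2) * P)) +
        γ / (1 - γ) * ((Be + Be * σθ / σn) / (1 - γ)) ^ 2 := by
      have hP' : Be ^ 2 * (1 + σθ ^ 2 / σn ^ 2) * P = Be ^ 2 * P +
          Be ^ 2 * σθ ^ 2 / σn ^ 2 * P := by ring
      gcongr
      linarith
    _ = _ := by ring

end DiscountedErrors

/-! ### From RKHS functions and states to weights and regressors. -/

section Assembly

variable {d D : ℕ}

theorem isRLS_posterior (γ σn σθ : ℝ) (ζ : Fin D → E d) (s : ℕ → E d) (r : ℕ → ℝ) :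
    IsRLS σn σθ (fun t => feature ζ (s t) - γ • feature ζ (s (t + 1))) r
      (thetaHat γ σn σθ ζ s r) (fun t => (posterior γ σn σθ ζ s r t).2) where
  mean_zero := rfl
  cov_zero := rfl
  mean_succ _ := rfl
  cov_succ _ := rfl

theorem avgSq_eq (e : ℕ → ℝ) (T : ℕ) : avgSq e T = (∑ t ∈ Finset.range T, e (t + 1) ^ 2) / T := by
  have : ∑ t ∈ Finset.Icc 1 T, e t ^ 2 = ∑ t ∈ Finset.range T, e (t + 1) ^ 2 := by
    induction T with
    | zero => simp
    | succ T ih => rw [Finset.sum_Icc_succ_top (by omega), ih, Finset.sum_range_succ]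
  rw [avgSq, this]

section LongTermReward

variable {γ : ℝ} {r : ℕ → ℝ} {R : ℝ}

theorem summable_discounted (hγ0 : 0 ≤ γ) (hγ1 : γ < 1) (hr : ∀ t, |r (t + 1)| ≤ R) (t : ℕ) :
    Summable fun k : ℕ => γ ^ k * r (t + 1 + k) := by
  refine Summable.of_norm_bounded ((summable_geometric_of_lt_one hγ0 hγ1).mul_right R) fun k => ?_
  rw [Real.norm_eq_abs, abs_mul, abs_of_nonneg (pow_nonneg hγ0 k), add_right_comm]
  exact mul_le_mul_of_nonneg_left (hr _) (pow_nonneg hγ0 k)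

theorem longTermReward_succ (hγ0 : 0 ≤ γ) (hγ1 : γ < 1) (hr : ∀ t, |r (t + 1)| ≤ R) (t : ℕ) :
    longTermReward γ r (t + 1) = r (t + 1) + γ * longTermReward γ r (t + 2) := by
  rw [longTermReward, (summable_discounted hγ0 hγ1 hr t).tsum_eq_zero_add, longTermReward,
    ← tsum_mul_left]
  simp only [pow_zero, one_mul, add_zero]
  congr 1
  refine tsum_congr fun k => ?_
  rw [show t + 1 + (k + 1) = t + 2 + k by ring]
  ring

theorem abs_longTermReward_le (hγ0 : 0 ≤ γ) (hγ1 : γ < 1) (hr : ∀ t, |r (t + 1)| ≤ R) (t : ℕ) :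
    |longTermReward γ r (t + 1)| ≤ (1 - γ)⁻¹ * R := by
  rw [← Real.norm_eq_abs]
  refine tsum_of_norm_bounded ((hasSum_geometric_of_lt_one hγ0 hγ1).mul_right R) fun k => ?_
  rw [Real.norm_eq_abs, abs_mul, abs_of_nonneg (pow_nonneg hγ0 k), add_right_comm]
  exact mul_le_mul_of_nonneg_left (hr _) (pow_nonneg hγ0 k)

end LongTermReward

/-- A kernel expansion with bounded coefficients is close to a linear function of the features
whenever the feature kernel is uniformly close to the kernel. -/
theorem exists_weights_of_expansion (hD : 1 ≤ D) {S : Set (E d)} {κbar : E d → E d → ℝ}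
    {ζ : Fin D → E d} {δ : ℝ}
    (hζ : ∀ s ∈ S, ∀ s' ∈ S, |feature ζ s ⬝ᵥ feature ζ s' - κbar s s'| ≤ δ) (hδ : 0 ≤ δ)
    {σθ M : ℝ} {F : Finset S} (α : F → ℝ) (hα : ∑ f, |α f| ≤ M) :
    ∃ w : Idx D → ℝ, w ⬝ᵥ w ≤ (σθ ^ 2 * M) ^ 2 ∧ ∀ s : S,
      |∑ f, α f * (σθ ^ 2 * κbar s f.1) - feature ζ s ⬝ᵥ w| ≤ σθ ^ 2 * M * δ := by
  have hM : 0 ≤ M := (Finset.sum_nonneg fun _ _ => abs_nonneg _).trans hα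
  set w : Idx D → ℝ := ∑ f, (σθ ^ 2 * α f) • feature ζ (f.1 : E d) with hw
  have hdot : ∀ x : Idx D → ℝ, x ⬝ᵥ w = ∑ f, σθ ^ 2 * α f * (x ⬝ᵥ feature ζ (f.1 : E d)) := by
    intro x
    rw [hw, dotProduct_sum]
    simp only [dotProduct_smul, smul_eq_mul]
  have hbound : ∀ (x : F → ℝ) (c : ℝ), (∀ f, |x f| ≤ c) → 0 ≤ c →
      |∑ f, σθ ^ 2 * α f * x f| ≤ σθ ^ 2 * M * c := by
    intro x c hx hc
    calc |∑ f, σθ ^ 2 * α f * x f| ≤ ∑ f, |σθ ^ 2 * α f * x f| := Finset.abs_sum_le_sum_abs _ _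
      _ ≤ ∑ f, σθ ^ 2 * |α f| * c := by
          refine Finset.sum_le_sum fun f _ => ?_
          rw [abs_mul, abs_mul, abs_of_nonneg (sq_nonneg σθ)]
          exact mul_le_mul_of_nonneg_left (hx f) (by positivity)
      _ = σθ ^ 2 * (∑ f, |α f|) * c := by rw [← Finset.sum_mul, ← Finset.mul_sum]
      _ ≤ σθ ^ 2 * M * c := by gcongr
  have hfw : ∀ s : E d, |feature ζ s ⬝ᵥ w| ≤ σθ ^ 2 * M := by
    intro s
    rw [hdot]
    simpa using hbound (fun f => feature ζ s ⬝ᵥ feature ζ (f.1 : E d)) 1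
      (fun f => abs_feature_dotProduct_le hD ζ _ _) zero_le_one
  refine ⟨w, ?_, fun s => ?_⟩
  · rw [hdot, sq (σθ ^ 2 * M)]
    refine (le_abs_self _).trans (hbound _ _ (fun f => ?_) (by positivity))
    rw [dotProduct_comm]
    exact hfw _
  · rw [hdot, ← Finset.sum_sub_distrib, Finset.sum_congr rfl fun f _ =>
      (show α f * (σθ ^ 2 * κbar s f.1) - σθ ^ 2 * α f * (feature ζ s ⬝ᵥ feature ζ (f.1 : E d)) =
        σθ ^ 2 * α f * (κbar s f.1 - feature ζ s ⬝ᵥ feature ζ (f.1 : E d)) by ring)]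
    refine hbound _ _ (fun f => ?_) hδ
    rw [abs_sub_comm]
    exact hζ _ s.2 _ f.1.2

theorem dotProduct_self_sub_le {ι : Type*} [Fintype ι] (x y : ι → ℝ) :
    (x - y) ⬝ᵥ (x - y) ≤ 2 * (x ⬝ᵥ x) + 2 * (y ⬝ᵥ y) := by
  have := dotProduct_self_nonneg_real (x + y)
  simp only [dotProduct_add, add_dotProduct, dotProduct_sub, sub_dotProduct] at this ⊢
  linarith

/-- Regressors whose two states share their kernel-net centres are close. -/
theorem regressor_dist_le (hD : 1 ≤ D) {γ : ℝ} (hγ0 : 0 ≤ γ) (hγ1 : γ < 1) {S : Set (E d)}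
    {κbar : E d → E d → ℝ} {ζ : Fin D → E d} {δ : ℝ}
    (hζ : ∀ s ∈ S, ∀ s' ∈ S, |feature ζ s ⬝ᵥ feature ζ s' - κbar s s'| ≤ δ) {η : ℝ}
    {p q a a' b b' : E d} (ha : a ∈ S) (ha' : a' ∈ S) (hb : b ∈ S) (hb' : b' ∈ S) (hp : p ∈ S)
    (hq : q ∈ S) (hap : 1 - κbar a p ≤ η) (hap' : 1 - κbar a' p ≤ η) (hbq : 1 - κbar b q ≤ η)
    (hbq' : 1 - κbar b' q ≤ η) :
    ((feature ζ a - γ • feature ζ b) - (feature ζ a' - γ • feature ζ b')) ⬝ᵥ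
      ((feature ζ a - γ • feature ζ b) - (feature ζ a' - γ • feature ζ b')) ≤
      32 * (η + δ) := by
  -- Features are unit vectors, so closeness in the kernel is closeness in norm. The constant grows
  -- from 2 to 8 through the common centre, and to 32 on combining the two states.
  have hdist : ∀ x ∈ S, ∀ y ∈ S, 1 - κbar x y ≤ η →
      (feature ζ x - feature ζ y) ⬝ᵥ (feature ζ x - feature ζ y) ≤ 2 * (η + δ) := by
    intro x hx y hy hxy
    have h1 := (abs_le.1 (hζ x hx y hy)).1
    simp only [dotProduct_sub, sub_dotProduct, feature_dotProduct_self hD,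
      dotProduct_comm (feature ζ y) (feature ζ x)]
    linarith
  have hpair : ∀ x ∈ S, ∀ y ∈ S, ∀ z ∈ S, 1 - κbar x z ≤ η → 1 - κbar y z ≤ η →
      (feature ζ x - feature ζ y) ⬝ᵥ (feature ζ x - feature ζ y) ≤ 8 * (η + δ) := by
    intro x hx y hy z hz hxz hyz
    have h1 := dotProduct_self_sub_le (feature ζ x - feature ζ z) (feature ζ y - feature ζ z)
    rw [sub_sub_sub_cancel_right] at h1
    linarith [hdist x hx z hz hxz, hdist y hy z hz hyz]
  have h1 := hpair a ha a' ha' p hp hap hap'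
  have h2 := hpair b hb b' hb' q hq hbq hbq'
  have h3 := dotProduct_self_sub_le (feature ζ a - feature ζ a')
    (γ • (feature ζ b - feature ζ b'))
  have h4 : (γ • (feature ζ b - feature ζ b')) ⬝ᵥ (γ • (feature ζ b - feature ζ b')) ≤
      (feature ζ b - feature ζ b') ⬝ᵥ (feature ζ b - feature ζ b') := by
    rw [smul_dotProduct, dotProduct_smul, smul_eq_mul, smul_eq_mul, ← mul_assoc]
    exact mul_le_of_le_one_left (dotProduct_self_nonneg_real _) (by nlinarith)
  rw [show (feature ζ a - γ • feature ζ b) - (feature ζ a' - γ • feature ζ b') =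
    (feature ζ a - feature ζ a') - γ • (feature ζ b - feature ζ b') by rw [smul_sub]; abel]
  linarith

/-- The cap at 1 reduces the quadratic term to a linear one; `|b|` is needed because the sign of
`Be` is unknown when `δ` is chosen. -/
theorem exists_pos_quadratic_le {K ε : ℝ} (hK : 0 < K) (hε : 0 < ε) (b : ℝ) :
    ∃ δ : ℝ, 0 < δ ∧ K * (4 * δ * |b| + 4 * δ ^ 2) ≤ ε / 4 := by
  refine ⟨min 1 (ε / (4 * K * (4 * |b| + 4))), by positivity, ?_⟩
  set δ := min 1 (ε / (4 * K * (4 * |b| + 4)))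
  have h0 : 0 < δ := by positivity
  have h1 : δ ≤ 1 := min_le_left _ _
  have h2 : δ ≤ ε / (4 * K * (4 * |b| + 4)) := min_le_right _ _
  rw [le_div_iff₀ (by positivity)] at h2
  have h3 : δ ^ 2 ≤ δ := by nlinarith
  have h4 : K * δ ^ 2 ≤ K * δ := by gcongr
  linarith

theorem exists_pos_mul_le {m ε : ℝ} (hm : 0 ≤ m) (hε : 0 < ε) :
    ∃ ρ : ℝ, 0 < ρ ∧ m * ρ ≤ ε / 4 := by
  refine ⟨ε / (4 * (m + 1)), by positivity, ?_⟩
  calc m * (ε / (4 * (m + 1))) ≤ (m + 1) * (ε / (4 * (m + 1))) := by gcongr; linarith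
    _ = ε / 4 := by field_simp

end Assembly

end OSGPTD

/-! ### Choice of constants and conclusion. -/

theorem theorem2 {d : ℕ} (γ σn σθ : ℝ) (hγ0 : 0 ≤ γ) (hγ1 : γ < 1) (hσn : 0 < σn) (hσθ : 0 < σθ)
    -- the bounded state space
    (S : Set (OSGPTD.E d)) (hS : Bornology.IsBounded S)
    -- the standardized kernel and its spectral distribution
    (κbar : OSGPTD.E d → OSGPTD.E d → ℝ) (π : MeasureTheory.Measure (OSGPTD.E d))
    [MeasureTheory.IsProbabilityMeasure π] (hκ : OSGPTD.IsStandardizedKernel κbar π)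
    -- the reproducing kernel Hilbert space of `κ = σθ² κbar` on the state space
    {H : Type*} [NormedAddCommGroup H] [InnerProductSpace ℝ H] [CompleteSpace H] [RKHS ℝ H S ℝ]
    (hH : ∀ s s' : S, RKHS.kernel H s s' 1 = σθ ^ 2 * κbar s s')
    -- the bound on the Bellman errors, the radius in `H`, and the accuracy
    (Be C ε : ℝ) (hε : 0 < ε) :
    ∃ A c : ℝ, 0 < A ∧ 0 < c ∧ ∃ T₀ : ℕ, ∀ D : ℕ, 1 ≤ D →
      ∀ (s : ℕ → S) (r : ℕ → ℝ),
        OSGPTD.freqLaw π D {ζ | ¬ (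
          (∀ t, 1 ≤ t → |OSGPTD.onlineBellman γ σn σθ ζ (fun t => (s t : OSGPTD.E d)) r t| ≤ Be) →
          ∀ v : H, ‖v‖ ≤ C → (∀ t, 1 ≤ t → |OSGPTD.fixedBellman γ v s r t| ≤ Be) →
          ∀ T : ℕ, T₀ ≤ T →
            OSGPTD.avgSq (OSGPTD.onlineError γ σn σθ ζ (fun t => (s t : OSGPTD.E d)) r) T ≤
              2 * (1 + γ) ^ 2 / (1 - γ) ^ 2 * OSGPTD.avgSq (OSGPTD.fixedError γ v s r) T + ε)}
        ≤ ENNReal.ofReal (A * Real.exp (-(c * D))) := by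
  classical
  open OSGPTD in
  have hγ' : 0 < 1 - γ := by linarith
  set K : ℝ := 2 / (1 - γ) ^ 2 with hK
  have hKpos : 0 < K := by positivity
  -- accuracy of the linear approximation
  obtain ⟨δ, hδ, hδK⟩ := exists_pos_quadratic_le hKpos hε Be
  -- rate of growth of the accumulated relative variances
  obtain ⟨ρ, hρ, hρK⟩ : ∃ ρ : ℝ, 0 < ρ ∧ K * (Be ^ 2 * (1 + σθ ^ 2 / σn ^ 2)) * ρ ≤ ε / 4 :=
    exists_pos_mul_le (by positivity) hε
  obtain ⟨k, hk⟩ := exists_nat_gt (4 / ρ)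
  have hk0 : (0 : ℝ) < k := lt_trans (by positivity) hk
  have hk0' : 0 < k := by exact_mod_cast hk0
  have hkρ : 2 / (k : ℝ) ≤ ρ / 2 := by
    rw [div_lt_iff₀ hρ] at hk
    rw [div_le_iff₀ hk0]
    linarith
  -- Chosen so that cells of squared diameter `32 * (η + η)` contribute exactly `ρ / 2` to the
  -- growth rate; `2 / k` takes the other half.
  set η : ℝ := ρ * σn ^ 2 / (4 * σθ ^ 2) / 64 with hη
  have hηpos : 0 < η := by positivity
  obtain ⟨F, M, hM, hF⟩ := exists_kernel_expansion (H := H) hκ hS hσθ hH C (δ := δ / 2)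
    (by positivity)
  obtain ⟨N, hN⟩ := exists_finset_kernel_net hκ hS hηpos
  choose cen hcenN hcen using hN
  set δ' : ℝ := min η (δ / 2 / (σθ ^ 2 * M + 1)) with hδ'
  have hδ'pos : 0 < δ' := by positivity
  have hδ'M : σθ ^ 2 * M * δ' ≤ δ / 2 := by
    have h1 : δ' ≤ δ / 2 / (σθ ^ 2 * M + 1) := min_le_right _ _
    rw [le_div_iff₀ (by positivity)] at h1
    linarith
  obtain ⟨A, c, hA, hc, hconc⟩ := uniform_kernel_concentration hκ hS hδ'pos
  -- All terms that do not grow with `T`. The number of cells comes from the kernel net, fixed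
  -- before `D` and the trajectory. `T₀` makes these terms at most `ε / 2` on average; the two `ε /
  -- 4` budgets cover the rest.
  set K₀ : ℝ := K * (γ * (1 + γ) * (Be / (1 - γ)) ^ 2 + σn ^ 2 / σθ ^ 2 * (σθ ^ 2 * M) ^ 2 +
    Be ^ 2 * (1 + σθ ^ 2 / σn ^ 2) * (Fintype.card (N × N) * k)) +
      γ / (1 - γ) * ((Be + Be * σθ / σn) / (1 - γ)) ^ 2 with hK₀
  obtain ⟨T₀, hT₀⟩ := exists_nat_gt (K₀ / (ε / 2))
  -- The bad event lies in the failure of kernel concentration, which involves neither trajectory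
  -- nor `v` nor `T`. The `+ 1` ensures `T > 0`.
  refine ⟨A, c, hA, hc, T₀ + 1, fun D hD s r => (measure_mono ?_).trans (hconc D hD)⟩
  intro ζ
  contrapose
  intro hζ
  rw [Set.mem_ofPred_eq, not_not] at hζ ⊢
  intro hon v hv hfixed T hT
  have hT0 : (0 : ℝ) < T := by
    have : 0 < T := by omega
    exact_mod_cast this
  have hb : ∀ t, |r (t + 1) - (feature ζ (s (t + 1) : E d) - γ • feature ζ (s (t + 2) : E d)) ⬝ᵥ
      thetaHat γ σn σθ ζ (fun t => (s t : E d)) r t| ≤ Be := fun t => hon (t + 1) (by omega)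
  have hBe : 0 ≤ Be := (abs_nonneg _).trans (hb 0)
  have hvB : ∀ t, |r (t + 1) - v (s (t + 1)) + γ * v (s (t + 2))| ≤ Be := fun t =>
    hfixed (t + 1) (by omega)
  have hvb : ∀ t, |v (s (t + 1))| ≤ σθ * C := fun t =>
    (abs_apply_le_norm hκ hσθ hH v _).trans (by gcongr)
  -- Bounded rewards are not assumed: they follow from the Bellman bound for `v` and the sup bound
  -- on `v`, and make the discounted sums converge.
  have hr : ∀ t, |r (t + 1)| ≤ Be + 2 * (σθ * C) := by
    intro t
    have h1 := abs_le.1 (hvB t)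
    have h2 := abs_le.1 (hvb t)
    have h3 : |γ * v (s (t + 2))| ≤ σθ * C := by
      rw [abs_mul, abs_of_nonneg hγ0]
      nlinarith [hvb (t + 1), abs_nonneg (v (s (t + 2)))]
    have h4 := abs_le.1 h3
    exact abs_le.2 ⟨by linarith, by linarith⟩
  obtain ⟨α, hα, hvα⟩ := hF v hv
  obtain ⟨w, hw, hwα⟩ := exists_weights_of_expansion (σθ := σθ) hD hζ hδ'pos.le α hα
  have hvw : ∀ t, |v (s (t + 1)) - feature ζ (s (t + 1) : E d) ⬝ᵥ w| ≤ δ := by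
    intro t
    refine (abs_sub_le _ (∑ f, α f * (σθ ^ 2 * κbar (s (t + 1)) f.1)) _).trans ?_
    linarith [hvα (s (t + 1)), hwα (s (t + 1))]
  have hRLS := isRLS_posterior γ σn σθ ζ (fun t => (s t : E d)) r
  have hratio := hRLS.sum_ratio_le hσn hσθ
    (fun t => ((⟨cen (s (t + 1)), hcenN _⟩, ⟨cen (s (t + 2)), hcenN _⟩) : N × N))
    (η := 32 * (η + δ')) (by positivity)
    (fun t τ hcell => by
      simp only [Prod.mk.injEq, Subtype.mk.injEq] at hcell
      refine regressor_dist_le hD hγ0 hγ1 hζ (s _).2 (s _).2 (s _).2 (s _).2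
        (cen (s (t + 1))).2 (cen (s (t + 2))).2 (hcen _) ?_ (hcen _) ?_
      · rw [hcell.1]; exact hcen _
      · rw [hcell.2]; exact hcen _) hk0' T
  have hrate : 2 / (k : ℝ) + 2 * (32 * (η + δ')) * σθ ^ 2 / σn ^ 2 ≤ ρ := by
    have h1 : δ' ≤ η := min_le_left _ _
    have h2 : 2 * (32 * (η + δ')) * σθ ^ 2 / σn ^ 2 ≤ 2 * (32 * (η + η)) * σθ ^ 2 / σn ^ 2 := by
      gcongr
    have h3 : 2 * (32 * (η + η)) * σθ ^ 2 / σn ^ 2 = ρ / 2 := by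
      rw [hη]
      field_simp
      norm_num
    linarith
  have hmain := IsRLS.sum_sq_error_le hγ0 hγ1 hσn hσθ hRLS
    (fun t => (feature_dotProduct_self hD ζ _).le) hb
    (V := longTermReward γ r) (v := fun t => v (s t))
    (longTermReward_succ hγ0 hγ1 hr) (abs_longTermReward_le hγ0 hγ1 hr) hvb hvB hw hvw
    (hratio.trans (add_le_add_right (mul_le_mul_of_nonneg_right hrate hT0.le) _))
  rw [avgSq_eq, avgSq_eq, mul_div_assoc', div_add' _ _ _ hT0.ne',
    div_le_div_iff_of_pos_right hT0]
  refine hmain.trans ?_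
  have hT₀' : K₀ ≤ ε / 2 * T := by
    rw [div_lt_iff₀ (by positivity)] at hT₀
    have : (T₀ : ℝ) ≤ T := by exact_mod_cast (by omega : T₀ ≤ T)
    calc K₀ ≤ T₀ * (ε / 2) := hT₀.le
      _ ≤ T * (ε / 2) := by gcongr
      _ = ε / 2 * T := mul_comm _ _
  have h1 := mul_le_mul_of_nonneg_right hδK hT0.le
  have h2 := mul_le_mul_of_nonneg_right hρK hT0.le
  rw [abs_of_nonneg hBe] at h1
  have hsum : 2 * (1 + γ) ^ 2 / (1 - γ) ^ 2 = K * (1 + γ) ^ 2 := by rw [hK]; ring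
  rw [hsum]
  simp only [fixedError]
  rw [hK₀] at hT₀'
  rw [← hK]
  linarith
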